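/- Let $\beta>3$ and $x_{\min}>0$, and let $\nu=\frac{\beta-1}{\beta-2}\,x_{\min}$ be the mean of the power-law distribution on $[x_{\min},\infty)$ with density $(\beta-1)x_{\min}^{\beta-1}x^{-\beta}$. Assume $\nu>1$. Let $G_n$ be the random power-law graph on $n$ vertices: the weights $p_1,\dots,p_n$ are independent samples from this distribution and, given the weights, every pair of distinct vertices $x,y$ is joined by an edge independently with probability $\min\{p_xp_y/\sum_z p_z,\,1\}$. Write $\mathrm{dist}_G(x,y)\in\{0,1,2,\dots\}\cup\{\infty\}$ for the graph distance ($\infty$ if $y$ is not reachable from $x$). A decoder is a function $D:\{0,1\}^*\times\{0,1\}^*\to\{0,1,2,\dots\}\cup\{\infty\}$. A labeling $L:V\to\{0,1\}^*$ of a graph $G$ recovers all distances exactly (with respect to $D$) if $D(L(x),L(y))=\mathrm{dist}_G(x,y)$ for all $x,y\in V$; its total length is $\sum_{x\in V}|L(x)|$. A 2-hop cover of $G$ assigns to every vertex $x$ two sets $L_F(x),L_B(x)\subseteq V$ (forward and backward landmarks) such that $\min_{z\in L_F(x)\cap L_B(y)}\big(\mathrm{dist}_G(x,z)+\mathrm{dist}_G(z,y)\big)=\mathrm{dist}_G(x,y)$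 for all $x,y\in V$ (with $\min\varnothing=\infty$); it stores $\sum_{x}(|L_F(x)|+|L_B(x)|)$ landmarks. Then there are constants $c>0$ and $k\in\mathbb N$, depending only on $\beta$ and $x_{\min}$, such that the following two statements hold. (1) For every sequence of decoders $(D_n)_n$ (where $D_n$ may depend on $n$ but not on the graph), with probability tending to $1$ as $n\to\infty$, every labeling of $G_n$ that recovers all distances exactly with respect to $D_n$ has total length at least $c\,n^{3/2}/(\log n)^k$. (2) With probability tending to $1$ as $n\to\infty$, every 2-hop cover of $G_n$ stores at least $c\,n^{3/2}/(\log n)^k$ landmarks. -/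

import Mathlib

open MeasureTheory ProbabilityTheory

/-! ### Chung–Lu graphs and random power-law graphs -/

/-- The volume `∑ x, p x` of a weight vector. -/
noncomputable def weightVolume {n : ℕ} (p : Fin n → ℝ) : ℝ := ∑ x, p x

/-- The Chung–Lu probability of the edge `{x, y}`, that is, `min (p x * p y / vol) 1` as an element
of the unit interval. (`Set.projIcc` also replaces negative values by `0`; this plays no role for
positive weights.) -/
noncomputable def chungLuEdgeProb {n : ℕ} (p : Fin n → ℝ) (e : Sym2 (Fin n)) : unitInterval :=
  Set.projIcc (0 : ℝ) 1 zero_le_one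
    (Sym2.lift ⟨fun x y => p x * p y / weightVolume p, fun x y => by simp only [mul_comm (p x)]⟩ e)

/-- The Chung–Lu random graph with weight vector `p`: each pair of distinct vertices is an edge
independently of the others, with probability `chungLuEdgeProb p`.
(`SimpleGraph.fromEdgeSet` discards loops.) -/
noncomputable def chungLuMeasure {n : ℕ} (p : Fin n → ℝ) : Measure (SimpleGraph (Fin n)) :=
  (Measure.pi fun e : Sym2 (Fin n) => bernoulliMeasure True False (chungLuEdgeProb p e)).map
    fun ω => SimpleGraph.fromEdgeSet {e | ω e}

/-- The power-law distribution with exponent `β`: density `(β - 1) xmin ^ (β - 1) x ^ (-β)`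
on `[xmin, ∞)`. -/
noncomputable def powerLaw (β xmin : ℝ) : Measure ℝ := paretoMeasure xmin (β - 1)

/-- The random power-law graph on `n` vertices: the weights are independent samples of the power
law, and given the weights the graph is a Chung–Lu random graph. -/
noncomputable def powerLawGraph (β xmin : ℝ) (n : ℕ) : Measure (SimpleGraph (Fin n)) :=
  (Measure.pi fun _ : Fin n => powerLaw β xmin).bind chungLuMeasure

lemma powerLaw_eq_withDensity (β xmin : ℝ) :
    powerLaw β xmin = volume.withDensity fun x =>
      ENNReal.ofReal (if xmin ≤ x then (β - 1) * xmin ^ (β - 1) * x ^ (-β) else 0) := by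
  unfold powerLaw paretoMeasure
  congr 1
  funext x
  rw [paretoPDF_eq, sub_add_cancel]

lemma chungLuEdgeProb_mk {n : ℕ} {p : Fin n → ℝ} (hp : ∀ x, 0 ≤ p x) (x y : Fin n) :
    (chungLuEdgeProb p s(x, y) : ℝ) = min (p x * p y / weightVolume p) 1 := by
  have h : 0 ≤ p x * p y / weightVolume p :=
    div_nonneg (mul_nonneg (hp x) (hp y)) (Finset.sum_nonneg fun z _ => hp z)
  simp only [chungLuEdgeProb, Sym2.lift_mk, Set.coe_projIcc]
  rw [min_comm, max_eq_right (le_min h zero_le_one)]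

lemma measurable_chungLuEdgeProb {n : ℕ} (e : Sym2 (Fin n)) :
    Measurable fun p : Fin n → ℝ => chungLuEdgeProb p e := by
  induction e with
  | h x y =>
    refine continuous_projIcc.measurable.comp ?_
    simp only [Sym2.lift_mk, weightVolume]
    fun_prop

instance {n : ℕ} (p : Fin n → ℝ) : IsProbabilityMeasure (chungLuMeasure p) :=
  Measure.isProbabilityMeasure_map (Measurable.of_discrete).aemeasurable

lemma measurable_chungLuMeasure {n : ℕ} :
    Measurable (chungLuMeasure : (Fin n → ℝ) → Measure (SimpleGraph (Fin n))) := by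
  refine (Measure.measurable_map _ Measurable.of_discrete).comp ?_
  refine Measurable.measure_of_isPiSystem_of_isProbabilityMeasure
    generateFrom_pi.symm isPiSystem_pi ?_
  rintro _ ⟨t, ht, rfl⟩
  simp only [Measure.pi_pi]
  refine Finset.measurable_prod _ fun e _ => ?_
  have hq := measurable_chungLuEdgeProb e
  simp only [bernoulliMeasure_def, Measure.add_apply, Measure.smul_apply]
  refine Measurable.add ?_ ?_
  · have h : Measurable fun p : Fin n → ℝ => unitInterval.toNNReal (chungLuEdgeProb p e) :=
      unitInterval.toNNReal_continuous.measurable.comp hq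
    simpa only [ENNReal.smul_def, smul_eq_mul] using h.coe_nnreal_ennreal.mul_const _
  · have h : Measurable fun p : Fin n → ℝ =>
        unitInterval.toNNReal (unitInterval.symm (chungLuEdgeProb p e)) :=
      (unitInterval.toNNReal_continuous.comp unitInterval.continuous_symm).measurable.comp hq
    simpa only [ENNReal.smul_def, smul_eq_mul] using h.coe_nnreal_ennreal.mul_const _

lemma isProbabilityMeasure_powerLawGraph {β xmin : ℝ} (hβ : 1 < β) (hx : 0 < xmin) (n : ℕ) :
    IsProbabilityMeasure (powerLawGraph β xmin n) := by
  have : IsProbabilityMeasure (powerLaw β xmin) :=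
    isProbabilityMeasure_paretoMeasure hx (sub_pos.2 hβ)
  constructor
  rw [powerLawGraph, Measure.bind_apply MeasurableSet.univ measurable_chungLuMeasure.aemeasurable]
  simp

/-! ### Distance labelings and 2-hop covers -/

/-- The labeling `L` of the vertices of `G` by bit strings recovers all distances exactly, when the
distance of `x` and `y` is computed from the two labels of `x` and `y` alone by the decoder `D`.
The distance of two vertices in different components is `⊤`. -/
def RecoversDistances {V : Type*} (D : List Bool → List Bool → ℕ∞) (G : SimpleGraph V)
    (L : V → List Bool) : Prop :=
  ∀ x y, D (L x) (L y) = G.edist x y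

/-- The total length (number of bits) of a labeling. -/
def totalLength {V : Type*} [Fintype V] (L : V → List Bool) : ℕ := ∑ x, (L x).length

/-- The sets `LF x` of forward landmarks and `LB x` of backward landmarks form a 2-hop cover of `G`:
for all `x` and `y`, the minimum of `dist x z + dist z y` over the common landmarks
`z ∈ LF x ∩ LB y` is the distance of `x` and `y` (the minimum over the empty set being `⊤`). -/
def IsTwoHopCover {V : Type*} [DecidableEq V] (G : SimpleGraph V) (LF LB : V → Finset V) : Prop :=
  ∀ x y, (⨅ z ∈ LF x ∩ LB y, (G.edist x z + G.edist z y)) = G.edist x y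

/-- The number of landmarks that are stored in total. -/
def totalLandmarks {V : Type*} [Fintype V] (LF LB : V → Finset V) : ℕ :=
  ∑ x, ((LF x).card + (LB x).card)

/-!
The lower bound is an entropy argument for groups of about `√n` vertices.

Write `lam = log n`, and condition on the weights `p`. With high probability they are typical
(`tendsto_not_typicalWeights`); in particular the growth rate `m = (∑ v, p v ^ 2) / (∑ v, p v)` of
the neighbourhoods of a vertex exceeds `1` by a constant, as it is at least the mean weight, and
`n / polylog n` vertices, the terminals, have a weight of a certain polylogarithmic order. Such a
weight is small enough to cost only logarithmic factors, and large enough for the neighbourhoods of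
almost every terminal to grow as expected.

Take a group of `2 * s` terminals with `s = √n / polylog n`, in two halves, and the depth `l` for
which `m ^ l` is `√n / polylog n`. Explore the balls of radius `l` around all terminals of the group
simultaneously (`explore`), and call a vertex of the last layer pure if it descends from a single
terminal.
* The explored region is small, and few pairs of terminals have distance at most `2 * l + 1`. Both
  follow from a count of paths (`edgeMeasure_edist_le`).
* For most terminals the pure part of the last layer has weight `√n / polylog n`. In every step the
  edges not looked at so far are independent of the past (`edgeMeasure_explore_le`), so Chebyshev's
  inequality (`edgeMeasure_growth`) shows that the weight of the pure part is multiplied by almost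
  `m`. Cutting off weights above a power of `lam` keeps the variance small and changes `m` only by a
  factor `1 - O(lam ^ (-3))`, which is harmless over at most `lam ^ 2` steps.
* The edges between two pure parts of last layers have not been looked at. If the distance of the
  two terminals is more than `2 * l + 1`, none of them is present. A labeling prescribes all
  distances in the group, and hence the absence of such edges for about `s ^ 2` pairs; this has
  probability at most `exp (-s ^ 2 / polylog n)` (`edgeMeasure_far_le`).

There are only `2 ^ (2 * s) * 4 ^ B` labelings of the group of total length at most `B`
(`exists_finset_labelings`). So it is unlikely that one with `B = s ^ 2 / polylog n` is correct
(`edgeMeasure_short_labels_le`). Cutting the set of all terminals into `n / (s * polylog n)` groups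
yields a total length of at least `n * s / polylog n`, that is, `n ^ (3 / 2) / polylog n`
(`edgeMeasure_totalLength_lt_le`).

A 2-hop cover is turned into a labeling by listing the landmarks of every vertex with their
distances, with `O(log n)` bits for each (`exists_decoder_of_twoHopCover`), so the bound for labels
implies the one for landmarks.
-/

/-! ### Random graphs with independent edges -/

/-- The random graph on `V` in which every pair of distinct vertices `e` is an edge with probability
`q e`, independently of the others. -/
noncomputable def edgeMeasure {V : Type*} [Fintype V] [DecidableEq V] (q : Sym2 V → unitInterval) :
    Measure (SimpleGraph V) :=
  (Measure.pi fun e : Sym2 V => bernoulliMeasure True False (q e)).map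
    fun ω => SimpleGraph.fromEdgeSet {e | ω e}

/-- The event `A` only depends on which pairs in `H` are edges. -/
def DeterminedOn {V : Type*} (H : Set (Sym2 V)) (A : Set (SimpleGraph V)) : Prop :=
  ∀ ⦃G G' : SimpleGraph V⦄, (∀ e ∈ H, e ∈ G.edgeSet ↔ e ∈ G'.edgeSet) → (G ∈ A ↔ G' ∈ A)

instance {V : Type*} [Finite V] : DiscreteMeasurableSpace (SimpleGraph V) := by
  have : MeasurableSingletonClass (SimpleGraph V) := by
    refine ⟨fun G => ?_⟩
    have : {G} = SimpleGraph.Adj ⁻¹' {G.Adj} := by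
      ext G'
      simp
    rw [this]
    exact SimpleGraph.measurable_adj (measurableSet_singleton _)
  infer_instance

section EdgeMeasure

variable {V : Type*} [Fintype V] [DecidableEq V] (q : Sym2 V → unitInterval)

instance : IsProbabilityMeasure (edgeMeasure q) :=
  Measure.isProbabilityMeasure_map (Measurable.of_discrete).aemeasurable

lemma edgeMeasure_apply (A : Set (SimpleGraph V)) :
    edgeMeasure q A = (Measure.pi fun e : Sym2 V => bernoulliMeasure True False (q e))
      {ω | SimpleGraph.fromEdgeSet {e | ω e} ∈ A} :=
  Measure.map_apply Measurable.of_discrete (.of_discrete)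

/-- Events that depend on disjoint sets of pairs are independent. -/
lemma edgeMeasure_inter {H H' : Set (Sym2 V)} {A B : Set (SimpleGraph V)} (hA : DeterminedOn H A)
    (hB : DeterminedOn H' B) (hd : Disjoint H H') :
    (edgeMeasure q).real (A ∩ B) = (edgeMeasure q).real A * (edgeMeasure q).real B := by
  classical
  set P := Measure.pi fun e : Sym2 V => bernoulliMeasure True False (q e) with hP
  have key : ∀ {H : Set (Sym2 V)} {A : Set (SimpleGraph V)}, DeterminedOn H A →
      {ω : Sym2 V → Prop | SimpleGraph.fromEdgeSet {e | ω e} ∈ A} =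
        (fun (ω : Sym2 V → Prop) (i : H.toFinset) => ω i) ⁻¹'
          ((fun (ω : Sym2 V → Prop) (i : H.toFinset) => ω i) ''
            {ω | SimpleGraph.fromEdgeSet {e | ω e} ∈ A}) := by
    intro H A hA
    refine (Set.subset_preimage_image _ _).antisymm ?_
    rintro ω ⟨ω', hω', h⟩
    refine (hA ?_).1 hω'
    intro e he
    have := congrFun h ⟨e, by simpa using he⟩
    simp only at this
    simp [SimpleGraph.edgeSet_fromEdgeSet, this]
  have hind : iIndepFun (fun (e : Sym2 V) (ω : Sym2 V → Prop) => ω e) P :=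
    iIndepFun_pi (X := fun _ => id) fun _ => aemeasurable_id
  have h2 := hind.indepFun_finset H.toFinset H'.toFinset
    (by simpa [Set.disjoint_toFinset] using hd) (fun i => measurable_pi_apply i)
  simp only [Measure.real, ← ENNReal.toReal_mul]
  congr 1
  rw [edgeMeasure_apply, edgeMeasure_apply, edgeMeasure_apply]
  have h3 := h2.measure_inter_preimage_eq_mul .of_discrete .of_discrete
    (s := (fun (ω : Sym2 V → Prop) (i : H.toFinset) => ω i) ''
            {ω | SimpleGraph.fromEdgeSet {e | ω e} ∈ A})
    (t := (fun (ω : Sym2 V → Prop) (i : H'.toFinset) => ω i) ''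
            {ω | SimpleGraph.fromEdgeSet {e | ω e} ∈ B})
  rw [← key hA, ← key hB] at h3
  exact h3

/-- The probability that none of the pairs in `U` is an edge. -/
lemma edgeMeasure_no_edge {U : Finset (Sym2 V)} (hU : ∀ e ∈ U, ¬ e.IsDiag) :
    (edgeMeasure q).real {G | ∀ e ∈ U, e ∉ G.edgeSet} = ∏ e ∈ U, (1 - (q e : ℝ)) := by
  rw [Measure.real, edgeMeasure_apply]
  have : {ω : Sym2 V → Prop | SimpleGraph.fromEdgeSet {e | ω e} ∈
      {G : SimpleGraph V | ∀ e ∈ U, e ∉ G.edgeSet}} =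
      Set.univ.pi fun e => if e ∈ U then {False} else Set.univ := by
    ext ω
    simp only [SimpleGraph.edgeSet_fromEdgeSet, Set.mem_ofPred_eq, Set.mem_pi, Set.mem_univ,
      true_imp_iff]
    refine forall_congr' fun e => ?_
    by_cases he : e ∈ U
    · have := hU e he
      simp [he, this]
    · simp [he]
  rw [this, Measure.pi_pi, ENNReal.toReal_prod, ← Finset.prod_subset (Finset.subset_univ U)]
  · refine Finset.prod_congr rfl fun e he => ?_
    rw [if_pos he, ← Measure.real,
      bernoulliMeasure_real_apply_of_notMem_of_mem _ (by simp) (by simp) (by simp)]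
  · intro e _ he
    simp [he]

lemma edgeMeasure_edge {e : Sym2 V} (he : ¬ e.IsDiag) :
    (edgeMeasure q).real {G | e ∈ G.edgeSet} = q e := by
  have h := edgeMeasure_no_edge q (U := {e}) (by simpa using he)
  have h2 : {G : SimpleGraph V | e ∈ G.edgeSet} = {G | ∀ e' ∈ ({e} : Finset (Sym2 V)),
      e' ∉ G.edgeSet}ᶜ := by ext G; simp
  rw [h2, probReal_compl_eq_one_sub (.of_discrete), h]
  simp

end EdgeMeasure

/-! ### Short distances are rare -/

/-- `PathAvoid G j A x y` says that there is a path with `j` edges from `x` to `y` in `G` whose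
vertices, apart from `x`, avoid the set `A`. -/
def PathAvoid {V : Type*} [DecidableEq V] (G : SimpleGraph V) : ℕ → Finset V → V → V → Prop
  | 0, _, x, y => x = y
  | j + 1, A, x, y => ∃ v, v ∉ insert x A ∧ G.Adj x v ∧ PathAvoid G j (insert x A) v y

section PathAvoid

variable {V : Type*} [DecidableEq V]

lemma pathAvoid_of_isPath {G : SimpleGraph V} {x y : V} (w : G.Walk x y) (hw : w.IsPath)
    (A : Finset V) (hA : ∀ v ∈ w.support, v ∉ A) : PathAvoid G w.length A x y := by
  induction w generalizing A with
  | nil => rfl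
  | @cons u v _ h w ih =>
    rw [SimpleGraph.Walk.cons_isPath_iff] at hw
    have hA' : ∀ z ∈ w.support, z ∉ insert u A := by
      intro z hz
      rw [Finset.mem_insert, not_or]
      exact ⟨fun h => hw.2 (h ▸ hz), hA z (by simp [hz])⟩
    exact ⟨v, hA' v (by simp), h, ih hw.1 _ hA'⟩

lemma exists_pathAvoid_of_edist_le {G : SimpleGraph V} {x y : V} {j : ℕ} (h : G.edist x y ≤ j) :
    ∃ i ≤ j, PathAvoid G i ∅ x y := by
  have hr : G.Reachable x y := by
    rw [← SimpleGraph.edist_ne_top_iff_reachable]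
    exact (h.trans_lt (ENat.natCast_lt_top j)).ne
  obtain ⟨w, hw, hl⟩ := hr.exists_path_of_dist
  refine ⟨w.length, ?_, pathAvoid_of_isPath w hw ∅ (by simp)⟩
  rw [hl]
  rw [← hr.coe_dist_eq_edist] at h
  exact_mod_cast h

lemma determinedOn_pathAvoid (j : ℕ) (A : Finset V) (v y : V) :
    v ∉ A → DeterminedOn {e : Sym2 V | ∀ a ∈ A, a ∉ e} {G | PathAvoid G j A v y} := by
  intro hv G G' h
  induction j generalizing v A with
  | zero => simp [PathAvoid]
  | succ j ih =>
    simp only [Set.mem_ofPred_eq, PathAvoid]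
    refine exists_congr fun u => and_congr_right fun hu => ?_
    have hadj := h s(v, u) (by
      intro a ha
      rw [Sym2.mem_iff, not_or]
      refine ⟨fun h => hv (h ▸ ha), fun h => hu ?_⟩
      rw [← h]
      exact Finset.mem_insert_of_mem ha)
    rw [SimpleGraph.mem_edgeSet, SimpleGraph.mem_edgeSet] at hadj
    refine and_congr hadj (ih (insert v A) u hu fun e he => h e fun a ha => he a ?_)
    exact Finset.mem_insert_of_mem ha

variable [Fintype V] (q : Sym2 V → unitInterval) {p : V → ℝ} {W : ℝ}

/-- The expected number of paths with `j + 1` edges between two vertices of weights `p x` and `p y`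
is at most `p x * p y / W` times the `j`-th power of the growth rate `(∑ v, p v ^ 2) / W`. -/
lemma edgeMeasure_pathAvoid_le (hp : ∀ v, 0 ≤ p v) (hW : 0 < W)
    (hq : ∀ u v, (q s(u, v) : ℝ) ≤ p u * p v / W) (j : ℕ) (A : Finset V) (x y : V) :
    (edgeMeasure q).real {G | PathAvoid G (j + 1) A x y} ≤
      p x * p y / W * ((∑ v, p v ^ 2) / W) ^ j := by
  have step : ∀ j A x, (edgeMeasure q).real {G | PathAvoid G (j + 1) A x y} ≤
      ∑ v, p x * p v / W * (edgeMeasure q).real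
        {G | v ∉ insert x A ∧ PathAvoid G j (insert x A) v y} := by
    intro j A x
    have hsub : {G | PathAvoid G (j + 1) A x y} ⊆ ⋃ v : V,
        ({G | s(x, v) ∈ G.edgeSet} ∩ {G | v ∉ insert x A ∧ PathAvoid G j (insert x A) v y}) := by
      rintro G ⟨v, hv, h1, h2⟩
      exact Set.mem_iUnion.2 ⟨v, h1, hv, h2⟩
    refine (measureReal_mono hsub).trans ((measureReal_iUnion_fintype_le _).trans ?_)
    refine Finset.sum_le_sum fun v _ => ?_
    by_cases hv : v ∈ insert x A
    · simp [hv]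
    have hxv : x ≠ v := by
      rintro rfl
      simp at hv
    have hd : DeterminedOn {e : Sym2 V | e = s(x, v)} {G : SimpleGraph V | s(x, v) ∈ G.edgeSet} :=
      fun G G' h => h _ rfl
    simp only [hv, not_false_iff, true_and]
    rw [edgeMeasure_inter q hd (determinedOn_pathAvoid j (insert x A) v y hv)
      (by
        rw [Set.disjoint_left]
        rintro e rfl h
        exact h x (Finset.mem_insert_self _ _) (Sym2.mem_mk_left _ _)),
      edgeMeasure_edge q (by simpa using hxv)]
    exact mul_le_mul_of_nonneg_right (hq x v) measureReal_nonneg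
  induction j generalizing A x with
  | zero =>
    refine (step 0 A x).trans ?_
    rw [Finset.sum_eq_single y]
    · rw [pow_zero]
      exact mul_le_mul_of_nonneg_left measureReal_le_one
        (div_nonneg (mul_nonneg (hp x) (hp y)) hW.le)
    · intro v _ hv
      simp [PathAvoid, hv]
    · simp
  | succ j ih =>
    refine (step (j + 1) A x).trans ?_
    calc _ ≤ ∑ v, p x * p v / W * (p v * p y / W * ((∑ v, p v ^ 2) / W) ^ j) := by
          refine Finset.sum_le_sum fun v _ => mul_le_mul_of_nonneg_left ?_
            (div_nonneg (mul_nonneg (hp x) (hp v)) hW.le)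
          exact (measureReal_mono fun G h => h.2).trans (ih _ v)
      _ = ∑ v, p v ^ 2 * (p x * p y / W * ((∑ v, p v ^ 2) / W) ^ j / W) := by
          refine Finset.sum_congr rfl fun v _ => ?_
          field_simp
      _ = _ := by
          rw [← Finset.sum_mul, pow_succ]
          ring

lemma edgeMeasure_edist_le (hp : ∀ v, 0 ≤ p v) (hW : 0 < W)
    (hq : ∀ u v, (q s(u, v) : ℝ) ≤ p u * p v / W) (j : ℕ) {x y : V} (hxy : x ≠ y) :
    (edgeMeasure q).real {G | G.edist x y ≤ j} ≤
      p x * p y / W * ∑ i ∈ Finset.range j, ((∑ v, p v ^ 2) / W) ^ i := by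
  have hsub : {G : SimpleGraph V | G.edist x y ≤ j} ⊆ ⋃ i ∈ Finset.range j,
      {G | PathAvoid G (i + 1) ∅ x y} := by
    intro G hG
    obtain ⟨i, hi, h⟩ := exists_pathAvoid_of_edist_le hG
    rcases i with _ | i
    · exact absurd h hxy
    · exact Set.mem_biUnion (Finset.mem_coe.2 (Finset.mem_range.2 hi)) h
  refine (measureReal_mono hsub (measure_ne_top _ _)).trans ((measureReal_biUnion_finset_le _ _).trans ?_)
  rw [Finset.mul_sum]
  exact Finset.sum_le_sum fun i _ => edgeMeasure_pathAvoid_le q hp hW hq i ∅ x y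

end PathAvoid

/-! ### Lower deviations of weighted sums of independent events -/

lemma one_sub_sum_le_prod_one_sub {ι : Type*} (s : Finset ι) {f : ι → ℝ} (h0 : ∀ i ∈ s, 0 ≤ f i)
    (h1 : ∀ i ∈ s, f i ≤ 1) : 1 - ∑ i ∈ s, f i ≤ ∏ i ∈ s, (1 - f i) := by
  classical
  induction s using Finset.induction_on with
  | empty => simp
  | insert a s ha ih =>
    rw [Finset.sum_insert ha, Finset.prod_insert ha]
    have h := ih (fun i hi => h0 i (Finset.mem_insert_of_mem hi))
      (fun i hi => h1 i (Finset.mem_insert_of_mem hi))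
    have ha0 := h0 a (Finset.mem_insert_self _ _)
    have ha1 := h1 a (Finset.mem_insert_self _ _)
    have hs : 0 ≤ ∑ i ∈ s, f i := Finset.sum_nonneg fun i hi => h0 i (Finset.mem_insert_of_mem hi)
    nlinarith

lemma prod_one_sub_le_exp {ι : Type*} (s : Finset ι) {f : ι → ℝ} (h1 : ∀ i ∈ s, f i ≤ 1) :
    ∏ i ∈ s, (1 - f i) ≤ Real.exp (-∑ i ∈ s, f i) := by
  rw [← Finset.sum_neg_distrib, Real.exp_sum]
  exact Finset.prod_le_prod (fun i hi => sub_nonneg.2 (h1 i hi))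
    fun i _ => Real.one_sub_le_exp_neg _

/-- Chebyshev's inequality for the total weight of those of the pairwise independent events `E v`
that occur, when no weight exceeds `K`. -/
lemma measureReal_sum_indicator_lt_le {Ω V : Type*} [MeasurableSpace Ω] {P : Measure Ω}
    [IsProbabilityMeasure P] (s : Finset V) {E : V → Set Ω} (hE : ∀ v, MeasurableSet (E v))
    (hind : ∀ v ∈ s, ∀ w ∈ s, v ≠ w → P.real (E v ∩ E w) = P.real (E v) * P.real (E w))
    {p : V → ℝ} {K ε m : ℝ} (hp : ∀ v ∈ s, 0 ≤ p v) (hK : ∀ v ∈ s, p v ≤ K)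
    (hm : m = ∑ v ∈ s, p v * P.real (E v)) (hm0 : 0 < m) (hε : 0 < ε) :
    P.real {ω | ∑ v ∈ s, (E v).indicator (fun _ => p v) ω < (1 - ε) * m} ≤ K / (ε ^ 2 * m) := by
  classical
  set X : V → Ω → ℝ := fun v => (E v).indicator fun _ => p v with hX
  have hmem : ∀ v ∈ s, MemLp (X v) 2 P := fun v _ => (memLp_const (p v)).indicator (hE v)
  have hint : ∀ v, ∫ ω, X v ω ∂P = p v * P.real (E v) := by
    intro v
    rw [hX, integral_indicator_const _ (hE v), smul_eq_mul, mul_comm]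
  have hcov : ∀ v ∈ s, ∀ w ∈ s, cov[X v, X w; P] ≤
      if v = w then K * (p v * P.real (E v)) else 0 := by
    intro v hv w hw
    rw [covariance_eq_sub (hmem v hv) (hmem w hw), hint, hint]
    have hmul : X v * X w = (E v ∩ E w).indicator fun _ => p v * p w := by
      ext ω
      simp only [hX, Pi.mul_apply, Set.inter_indicator_mul]
    rw [hmul, integral_indicator_const _ ((hE v).inter (hE w)), smul_eq_mul]
    split_ifs with h
    · subst h
      rw [Set.inter_self]
      have h1 : 0 ≤ p v * P.real (E v) := mul_nonneg (hp v hv) measureReal_nonneg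
      nlinarith [hK v hv, mul_nonneg h1 h1, mul_le_mul_of_nonneg_left (hK v hv) h1]
    · rw [hind v hv w hw h]
      apply le_of_eq
      ring
  have hvar : Var[∑ v ∈ s, X v; P] ≤ K * m := by
    rw [variance_sum' hmem, hm, Finset.mul_sum]
    refine Finset.sum_le_sum fun v hv => ?_
    refine (Finset.sum_le_sum fun w hw => hcov v hv w hw).trans (le_of_eq ?_)
    simp [hv]
  have hmean : P[∑ v ∈ s, X v] = m := by
    simp only [Finset.sum_apply]
    rw [integral_finsetSum _ fun v hv => (hmem v hv).integrable (by norm_num), hm]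
    exact Finset.sum_congr rfl fun v _ => hint v
  have hc := meas_ge_le_variance_div_sq (memLp_finsetSum' s hmem) (mul_pos hε hm0)
  have hsub : {ω | ∑ v ∈ s, X v ω < (1 - ε) * m} ⊆
      {ω | ε * m ≤ |(∑ v ∈ s, X v) ω - P[∑ v ∈ s, X v]|} := by
    intro ω hω
    rw [Set.mem_ofPred_eq] at hω
    rw [Set.mem_ofPred_eq, hmean, Finset.sum_apply, abs_sub_comm]
    refine le_trans ?_ (le_abs_self _)
    linarith
  refine (measureReal_mono hsub).trans ?_
  rw [Measure.real]
  refine (ENNReal.toReal_mono ENNReal.ofReal_ne_top hc).trans ?_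
  rw [ENNReal.toReal_ofReal (div_nonneg (variance_nonneg _ _) (sq_nonneg _))]
  calc _ ≤ K * m / (ε * m) ^ 2 := by gcongr
    _ = _ := by field_simp

/-! ### Exploring the balls around a family of vertices -/

/-- A stage of the simultaneous breadth-first exploration from a family of vertices (indexed by
`ι`): the vertices `inner` all of whose edges have been looked at, the last `layer` of vertices
found, and, for every root, the set `pure` of those vertices of the layer that descend from this
root alone. -/
@[ext]
structure Exploration (V ι : Type*) where
  inner : Finset V
  layer : Finset V
  pure : ι → Finset V

open Classical in
/-- One step of the exploration: look at the edges between the last layer and the vertices not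
found so far. A vertex descends from the root `a` alone if it is adjacent to a vertex with this
property and to no other vertex of the last layer; only vertices in `light` are retained. -/
noncomputable def Exploration.next {V ι : Type*} [Fintype V] [DecidableEq V] (G : SimpleGraph V)
    (light : Finset V) (σ : Exploration V ι) : Exploration V ι where
  inner := σ.inner ∪ σ.layer
  layer := Finset.univ.filter fun v => v ∉ σ.inner ∪ σ.layer ∧ ∃ u ∈ σ.layer, G.Adj u v
  pure a := (light \ (σ.inner ∪ σ.layer)).filter fun v =>
    (∃ u ∈ σ.pure a, G.Adj u v) ∧ ∀ u ∈ σ.layer \ σ.pure a, ¬ G.Adj u v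

/-- The exploration of `G` from the roots `t`, after `i` steps. -/
noncomputable def explore {V ι : Type*} [Fintype V] [DecidableEq V] [Fintype ι]
    (t : ι → V) (light : Finset V) (G : SimpleGraph V) : ℕ → Exploration V ι
  | 0 => ⟨∅, Finset.univ.image t, fun a => {t a}⟩
  | i + 1 => (explore t light G i).next G light

/-- The pairs of vertices that touch the set `I`. -/
def touching {V : Type*} (I : Finset V) : Set (Sym2 V) := {e | ∃ v ∈ I, v ∈ e}

section Exploration

variable {V ι : Type*} [Fintype V] [DecidableEq V] [Fintype ι] (t : ι → V) (light : Finset V)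

lemma explore_succ_inner (G : SimpleGraph V) (i : ℕ) : (explore t light G (i + 1)).inner =
    (explore t light G i).inner ∪ (explore t light G i).layer := rfl

lemma mem_explore_succ_layer {G : SimpleGraph V} {i : ℕ} {v : V} :
    v ∈ (explore t light G (i + 1)).layer ↔
      v ∉ (explore t light G i).inner ∪ (explore t light G i).layer ∧
        ∃ u ∈ (explore t light G i).layer, G.Adj u v := by
  simp [explore, Exploration.next]

lemma mem_explore_succ_pure {G : SimpleGraph V} {i : ℕ} {a : ι} {v : V} :
    v ∈ (explore t light G (i + 1)).pure a ↔
      (v ∈ light ∧ v ∉ (explore t light G i).inner ∪ (explore t light G i).layer) ∧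
        (∃ u ∈ (explore t light G i).pure a, G.Adj u v) ∧
        ∀ u ∈ (explore t light G i).layer \ (explore t light G i).pure a, ¬ G.Adj u v := by
  simp only [explore, Exploration.next, Finset.mem_filter, Finset.mem_sdiff]

lemma explore_pure_subset (G : SimpleGraph V) (i : ℕ) (a : ι) :
    (explore t light G i).pure a ⊆ (explore t light G i).layer := by
  induction i with
  | zero => simp [explore]
  | succ i ih =>
    intro v hv
    obtain ⟨⟨_, hv⟩, ⟨u, hu, huv⟩, _⟩ := (mem_explore_succ_pure t light).1 hv
    exact (mem_explore_succ_layer t light).2 ⟨hv, u, ih hu, huv⟩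

lemma explore_layer_disjoint (G : SimpleGraph V) (i : ℕ) :
    Disjoint (explore t light G i).inner (explore t light G i).layer := by
  cases i with
  | zero => simp [explore]
  | succ i =>
    rw [Finset.disjoint_right]
    intro v hv
    exact ((mem_explore_succ_layer t light).1 hv).1

lemma explore_pure_disjoint (ht : Function.Injective t) (G : SimpleGraph V) (i : ℕ) {a b : ι}
    (hab : a ≠ b) : Disjoint ((explore t light G i).pure a) ((explore t light G i).pure b) := by
  induction i with
  | zero => simpa [explore] using ht.ne hab
  | succ i ih =>
    rw [Finset.disjoint_left]
    intro v ha hb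
    obtain ⟨_, ⟨u, hu, huv⟩, _⟩ := (mem_explore_succ_pure t light).1 ha
    obtain ⟨_, _, h⟩ := (mem_explore_succ_pure t light).1 hb
    exact h u (Finset.mem_sdiff.2 ⟨explore_pure_subset t light G i a hu,
      Finset.disjoint_left.1 ih hu⟩) huv

lemma edist_le_of_mem_explore_pure {G : SimpleGraph V} {i : ℕ} {a : ι} {v : V}
    (hv : v ∈ (explore t light G i).pure a) : G.edist (t a) v ≤ i := by
  induction i generalizing v with
  | zero =>
    have : v = t a := by simpa [explore] using hv
    simp [this]
  | succ i ih =>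
    obtain ⟨_, ⟨u, hu, huv⟩, _⟩ := (mem_explore_succ_pure t light).1 hv
    refine (SimpleGraph.edist_triangle (v := u)).trans ?_
    rw [Nat.cast_add]
    exact add_le_add (ih hu) (SimpleGraph.edist_eq_one_iff_adj.2 huv).le

lemma exists_edist_le_of_mem_explore {G : SimpleGraph V} {i : ℕ} {v : V}
    (hv : v ∈ (explore t light G i).inner ∪ (explore t light G i).layer) :
    ∃ a, G.edist (t a) v ≤ i := by
  induction i generalizing v with
  | zero =>
    obtain ⟨a, rfl⟩ : ∃ a, t a = v := by simpa [explore] using hv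
    exact ⟨a, by simp⟩
  | succ i ih =>
    rcases Finset.mem_union.1 hv with h | h
    · obtain ⟨a, ha⟩ := ih h
      exact ⟨a, ha.trans (by exact_mod_cast Nat.le_succ i)⟩
    · obtain ⟨_, u, hu, huv⟩ := (mem_explore_succ_layer t light).1 h
      obtain ⟨a, ha⟩ := ih (Finset.mem_union_right _ hu)
      refine ⟨a, (SimpleGraph.edist_triangle (v := u)).trans ?_⟩
      rw [Nat.cast_add]
      exact add_le_add ha (SimpleGraph.edist_eq_one_iff_adj.2 huv).le

/-- The first `i` steps of the exploration are determined by the edges that have been looked at. -/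
lemma explore_congr (i : ℕ) {G G' : SimpleGraph V}
    (h : ∀ e ∈ touching (explore t light G i).inner, e ∈ G.edgeSet ↔ e ∈ G'.edgeSet) :
    explore t light G' i = explore t light G i := by
  induction i with
  | zero => rfl
  | succ i ih =>
    rw [explore_succ_inner] at h
    have h0 := ih fun e ⟨v, hv, hve⟩ => h e ⟨v, Finset.mem_union_left _ hv, hve⟩
    have hadj : ∀ u ∈ (explore t light G i).layer, ∀ v, G.Adj u v ↔ G'.Adj u v := by
      intro u hu v
      rw [← SimpleGraph.mem_edgeSet, ← SimpleGraph.mem_edgeSet]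
      exact h _ ⟨u, Finset.mem_union_right _ hu, Sym2.mem_mk_left _ _⟩
    have hp := explore_pure_subset t light G i
    ext a
    · rw [explore_succ_inner, explore_succ_inner, h0]
    · rw [mem_explore_succ_layer, mem_explore_succ_layer, h0]
      refine and_congr_right fun _ => exists_congr fun u => ?_
      exact and_congr_right fun hu => (hadj u hu _).symm
    · rw [mem_explore_succ_pure, mem_explore_succ_pure, h0]
      refine and_congr_right fun _ => and_congr ?_ ?_
      · exact exists_congr fun u => and_congr_right fun hu => (hadj u (hp _ hu) _).symm
      · refine forall_congr' fun u => imp_congr_right fun hu => not_congr (hadj u ?_ _).symm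
        exact (Finset.mem_sdiff.1 hu).1

lemma determinedOn_explore_eq (i : ℕ) (σ : Exploration V ι) :
    DeterminedOn (touching σ.inner) {G | explore t light G i = σ} := by
  have key : ∀ {G G' : SimpleGraph V}, (∀ e ∈ touching σ.inner, e ∈ G.edgeSet ↔ e ∈ G'.edgeSet) →
      explore t light G i = σ → explore t light G' i = σ := by
    rintro G G' h rfl
    exact explore_congr t light i h
  exact fun G G' h => ⟨key h, key fun e he => (h e he).symm⟩

/-- Given the first `i` steps of the exploration, the edges that have not been looked at are
independent: a bound, uniform in the stage `σ`, for the probability of an event `B σ` about these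
edges bounds the probability that the event happens for the random stage. -/
lemma edgeMeasure_explore_le (q : Sym2 V → unitInterval) (i : ℕ) (Q : Set (Exploration V ι))
    {B : Exploration V ι → Set (SimpleGraph V)} {δ : ℝ} (hδ : 0 ≤ δ)
    (hB : ∀ G, explore t light G i ∈ Q →
      DeterminedOn (touching (explore t light G i).inner)ᶜ (B (explore t light G i)))
    (hP : ∀ G, explore t light G i ∈ Q → (edgeMeasure q).real (B (explore t light G i)) ≤ δ) :
    (edgeMeasure q).real {G | explore t light G i ∈ Q ∧ G ∈ B (explore t light G i)} ≤ δ := by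
  classical
  have := Fintype.ofFinite (SimpleGraph V)
  set f : SimpleGraph V → Exploration V ι := fun G => explore t light G i with hf
  set S := (Finset.univ.image f).filter (· ∈ Q) with hS
  have hsub : {G | f G ∈ Q ∧ G ∈ B (f G)} ⊆ ⋃ σ ∈ S, ({G | f G = σ} ∩ B σ) := by
    rintro G ⟨h1, h2⟩
    exact Set.mem_biUnion (x := f G) (by simp [hS, h1]) ⟨rfl, h2⟩
  refine (measureReal_mono hsub (measure_ne_top _ _)).trans
    ((measureReal_biUnion_finset_le _ _).trans ?_)
  have h1 : ∀ σ ∈ S, (edgeMeasure q).real ({G | f G = σ} ∩ B σ) ≤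
      (edgeMeasure q).real (f ⁻¹' {σ}) * δ := by
    intro σ hσ
    obtain ⟨hσ1, hσ2⟩ := Finset.mem_filter.1 hσ
    obtain ⟨G, _, rfl⟩ := Finset.mem_image.1 hσ1
    rw [edgeMeasure_inter q (determinedOn_explore_eq t light i _) (hB G hσ2) disjoint_compl_right]
    exact mul_le_mul_of_nonneg_left (hP G hσ2) measureReal_nonneg
  refine (Finset.sum_le_sum h1).trans ?_
  rw [← Finset.sum_mul, sum_measureReal_preimage_singleton S (fun _ _ => .of_discrete)]
  exact mul_le_of_le_one_left hδ measureReal_le_one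

end Exploration

/-! ### One step of the exploration -/

section Growth

variable {V : Type*} [DecidableEq V]

/-- The event that `v` is adjacent to a vertex of `F` and to no vertex of `L \ F`. -/
def attachedOnly (F L : Finset V) (v : V) : Set (SimpleGraph V) :=
  {G | (∃ u ∈ F, G.Adj u v) ∧ ∀ u ∈ L \ F, ¬ G.Adj u v}

lemma determinedOn_attachedOnly {F L : Finset V} (hFL : F ⊆ L) (v : V) :
    DeterminedOn {e | ∃ u ∈ L, e = s(u, v)} (attachedOnly F L v) := by
  intro G G' h
  have hadj : ∀ u ∈ L, (G.Adj u v ↔ G'.Adj u v) := fun u hu => h s(u, v) ⟨u, hu, rfl⟩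
  refine and_congr (exists_congr fun u => and_congr_right fun hu => hadj u (hFL hu)) ?_
  exact forall_congr' fun u => imp_congr_right fun hu =>
    not_congr (hadj u (Finset.mem_sdiff.1 hu).1)

variable [Fintype V] (q : Sym2 V → unitInterval)

lemma edgeMeasure_no_adj {L : Finset V} {v : V} (hv : v ∉ L) :
    (edgeMeasure q).real {G | ∀ u ∈ L, ¬ G.Adj u v} = ∏ u ∈ L, (1 - (q s(u, v) : ℝ)) := by
  have h := edgeMeasure_no_edge q (U := L.image fun u => s(u, v)) (by
    intro e he
    obtain ⟨u, hu, rfl⟩ := Finset.mem_image.1 he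
    rw [Sym2.mk_isDiag_iff]
    rintro rfl
    exact hv hu)
  rw [Finset.prod_image] at h
  · rw [← h]
    congr 1
    ext G
    simp
  · intro u _ w _ huw
    rcases Sym2.eq_iff.1 huw with ⟨h, _⟩ | ⟨h, h'⟩
    · exact h
    · exact h.trans h'

/-- If `v` has on average `c ≤ 1` neighbours in `L`, then it is attached to the subset `F` alone
with almost the mean number of its neighbours in `F` as probability. -/
lemma le_edgeMeasure_attachedOnly {F L : Finset V} (hFL : F ⊆ L) {v : V} (hv : v ∉ L)
    (hc : ∑ u ∈ L, (q s(u, v) : ℝ) ≤ 1) :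
    (∑ u ∈ F, (q s(u, v) : ℝ)) * (1 - ∑ u ∈ L, (q s(u, v) : ℝ)) ≤
      (edgeMeasure q).real (attachedOnly F L v) := by
  have hset : attachedOnly F L v =
      {G : SimpleGraph V | ∀ u ∈ L \ F, ¬ G.Adj u v} \ {G | ∀ u ∈ L, ¬ G.Adj u v} := by
    ext G
    simp only [attachedOnly, Set.mem_ofPred_eq, Set.mem_sdiff, not_forall, not_not]
    rw [and_comm]
    refine and_congr_right fun h => ⟨fun ⟨u, hu, huv⟩ => ⟨u, hFL hu, huv⟩, ?_⟩
    rintro ⟨u, hu, huv⟩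
    refine ⟨u, ?_, huv⟩
    by_contra hF
    exact h u (Finset.mem_sdiff.2 ⟨hu, hF⟩) huv
  have hsub : {G : SimpleGraph V | ∀ u ∈ L, ¬ G.Adj u v} ⊆ {G | ∀ u ∈ L \ F, ¬ G.Adj u v} :=
    fun G (h : ∀ u ∈ L, ¬ G.Adj u v) u hu => h u (Finset.mem_sdiff.1 hu).1
  rw [hset, measureReal_sdiff hsub .of_discrete,
    edgeMeasure_no_adj q (fun h => hv (Finset.mem_sdiff.1 h).1), edgeMeasure_no_adj q hv,
    ← Finset.prod_sdiff hFL]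
  have hq0 : ∀ u, 0 ≤ (q s(u, v) : ℝ) := fun u => (q s(u, v)).2.1
  have hq1 : ∀ u, (q s(u, v) : ℝ) ≤ 1 := fun u => (q s(u, v)).2.2
  have hsum := Finset.sum_sdiff hFL (f := fun u => (q s(u, v) : ℝ))
  set A := ∑ u ∈ F, (q s(u, v) : ℝ)
  set C := ∑ u ∈ L \ F, (q s(u, v) : ℝ)
  have hA : 0 ≤ A := Finset.sum_nonneg fun u _ => hq0 u
  have hC : 0 ≤ C := Finset.sum_nonneg fun u _ => hq0 u
  have h1 : 1 - C ≤ ∏ u ∈ L \ F, (1 - (q s(u, v) : ℝ)) :=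
    one_sub_sum_le_prod_one_sub _ (fun u _ => hq0 u) fun u _ => hq1 u
  have h2 : ∏ u ∈ F, (1 - (q s(u, v) : ℝ)) ≤ 1 - A * (1 - A) := by
    refine (prod_one_sub_le_exp F fun u _ => hq1 u).trans ?_
    have h3 : Real.exp (-A) * (1 + A) ≤ 1 := by
      rw [Real.exp_neg, inv_mul_le_one₀ (Real.exp_pos _)]
      linarith [Real.add_one_le_exp A]
    have h4 : Real.exp (-A) ≤ 1 / (1 + A) := by rwa [le_div_iff₀ (by linarith)]
    refine h4.trans ?_
    rw [div_le_iff₀ (by linarith)]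
    nlinarith [mul_nonneg hA (mul_nonneg hA hA)]
  have h5 : 0 ≤ A * (1 - A) := mul_nonneg hA (by linarith)
  have h6 : A * (1 - A) ≤ 1 - ∏ u ∈ F, (1 - (q s(u, v) : ℝ)) := by linarith
  have h7 := mul_le_mul h1 h6 h5 (Finset.prod_nonneg fun u _ => sub_nonneg.2 (hq1 u))
  rw [← mul_one_sub]
  refine le_trans ?_ h7
  rw [← hsum]
  nlinarith [mul_nonneg hA (mul_nonneg hA hC)]

/-- One step of the exploration, seen from a single root: `F` is the pure part of the last layer `L`
and `B` the set of all vertices found so far. With high probability the total weight of the new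
vertices attached to `F` alone is at least the weight of `F` times almost the growth rate `m`. -/
lemma edgeMeasure_growth {p : V → ℝ} {W K ε m : ℝ} {F L B light : Finset V} (hp : ∀ v, 0 < p v)
    (hW : 0 < W) (hq : ∀ u v, (q s(u, v) : ℝ) ≤ p u * p v / W)
    (hqF : ∀ u ∈ F, ∀ v ∈ light, (q s(u, v) : ℝ) = p u * p v / W) (hFL : F ⊆ L) (hLB : L ⊆ B)
    (hF : F.Nonempty) (hlight : ∀ v ∈ light, p v ≤ K) (hL : K * ∑ u ∈ L, p u ≤ ε * W)
    (hB : (1 - 2 * ε) * m * W ≤ ∑ v ∈ light \ B, p v ^ 2) (hm : 0 < m) (hε : 0 < ε)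
    (hε1 : 4 * ε ≤ 1) :
    (edgeMeasure q).real {G | ∑ v ∈ light \ B, (attachedOnly F L v).indicator (fun _ => p v) G <
        (1 - 4 * ε) * m * ∑ u ∈ F, p u} ≤
      K / (ε ^ 2 * ((1 - 3 * ε) * m * ∑ u ∈ F, p u)) := by
  have hFpos : 0 < ∑ u ∈ F, p u := Finset.sum_pos (fun u _ => hp u) hF
  have hnotin : ∀ v ∈ light \ B, v ∉ L := fun v hv h => (Finset.mem_sdiff.1 hv).2 (hLB h)
  set M := ∑ v ∈ light \ B, p v * (edgeMeasure q).real (attachedOnly F L v) with hM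
  have hprob : ∀ v ∈ light \ B, (1 - ε) * ((∑ u ∈ F, p u) / W) * p v ≤
      (edgeMeasure q).real (attachedOnly F L v) := by
    intro v hv
    have hvl := (Finset.mem_sdiff.1 hv).1
    have hcε : ∑ u ∈ L, (q s(u, v) : ℝ) ≤ ε := by
      calc ∑ u ∈ L, (q s(u, v) : ℝ) ≤ ∑ u ∈ L, p u * p v / W := Finset.sum_le_sum fun u _ => hq u v
        _ = p v * (∑ u ∈ L, p u) / W := by
            rw [← Finset.sum_div, ← Finset.sum_mul, mul_comm]
        _ ≤ K * (∑ u ∈ L, p u) / W := by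
            gcongr
            · exact Finset.sum_nonneg fun u _ => (hp u).le
            · exact hlight v hvl
        _ ≤ ε := by rwa [div_le_iff₀ hW]
    refine le_trans ?_ (le_edgeMeasure_attachedOnly q hFL (hnotin v hv) (by linarith))
    have hA : ∑ u ∈ F, (q s(u, v) : ℝ) = (∑ u ∈ F, p u) / W * p v := by
      rw [Finset.sum_congr rfl fun u hu => hqF u hu v hvl, ← Finset.sum_div, ← Finset.sum_mul]
      ring
    rw [hA]
    have h0 : 0 ≤ (∑ u ∈ F, p u) / W * p v := by have := (hp v).le; positivity
    nlinarith
  have hMge : (1 - 3 * ε) * m * ∑ u ∈ F, p u ≤ M := by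
    calc (1 - 3 * ε) * m * ∑ u ∈ F, p u ≤
          (1 - ε) * ((∑ u ∈ F, p u) / W) * ((1 - 2 * ε) * m * W) := by
          have h : (1 - ε) * ((∑ u ∈ F, p u) / W) * ((1 - 2 * ε) * m * W) =
            (1 - 3 * ε) * m * (∑ u ∈ F, p u) + 2 * ε ^ 2 * m * ∑ u ∈ F, p u := by
            field_simp
            ring
          rw [h]
          have : 0 ≤ 2 * ε ^ 2 * m * ∑ u ∈ F, p u := by positivity
          linarith
      _ ≤ (1 - ε) * ((∑ u ∈ F, p u) / W) * ∑ v ∈ light \ B, p v ^ 2 := by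
          refine mul_le_mul_of_nonneg_left hB (mul_nonneg (by linarith) ?_)
          positivity
      _ ≤ M := by
          rw [hM, Finset.mul_sum]
          refine Finset.sum_le_sum fun v hv => ?_
          have := mul_le_mul_of_nonneg_left (hprob v hv) (hp v).le
          refine le_trans (le_of_eq ?_) this
          ring
  have hM1 : 0 < (1 - 3 * ε) * m * ∑ u ∈ F, p u := by
    have : 0 < 1 - 3 * ε := by linarith
    positivity
  have hind : ∀ v ∈ light \ B, ∀ w ∈ light \ B, v ≠ w →
      (edgeMeasure q).real (attachedOnly F L v ∩ attachedOnly F L w) =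
        (edgeMeasure q).real (attachedOnly F L v) * (edgeMeasure q).real (attachedOnly F L w) := by
    intro v hv w hw hvw
    -- The two events concern different edges, because neither `v` nor `w` lies in `L`.
    refine edgeMeasure_inter q (determinedOn_attachedOnly hFL v) (determinedOn_attachedOnly hFL w) ?_
    rw [Set.disjoint_left]
    rintro e ⟨u, hu, rfl⟩ ⟨u', hu', h⟩
    rcases Sym2.eq_iff.1 h with ⟨_, h⟩ | ⟨_, h⟩
    · exact hvw h
    · exact hnotin v hv (h ▸ hu')
  have hcheb := measureReal_sum_indicator_lt_le (P := edgeMeasure q) (light \ B)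
    (E := attachedOnly F L) (fun _ => .of_discrete) hind (fun v _ => (hp v).le)
    (fun v hv => hlight v (Finset.mem_sdiff.1 hv).1) hM (hM1.trans_le hMge) hε
  have hK : 0 ≤ K := by
    by_contra hK
    have hemp : light \ B = ∅ := by
      rw [Finset.eq_empty_iff_forall_notMem]
      intro v hv
      linarith [hp v, hlight v (Finset.mem_sdiff.1 hv).1]
    rw [hM, hemp, Finset.sum_empty] at hMge
    linarith
  refine (measureReal_mono fun G hG => ?_).trans (hcheb.trans ?_)
  · rw [Set.mem_ofPred_eq] at hG ⊢
    refine hG.trans_le ?_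
    have h1 := mul_le_mul_of_nonneg_left hMge (show (0 : ℝ) ≤ 1 - ε by linarith)
    refine le_trans ?_ h1
    have : 0 ≤ 3 * ε ^ 2 * (m * ∑ u ∈ F, p u) := by positivity
    nlinarith
  · gcongr

end Growth

/-! ### Total weight of the balls and growth of the pure layers -/

/-- Markov's inequality for the total weight of those of the events `E i` that occur. -/
lemma mul_measureReal_le_sum_indicator {Ω ι : Type*} [MeasurableSpace Ω] {P : Measure Ω}
    [IsProbabilityMeasure P] (s : Finset ι) {E : ι → Set Ω} (hE : ∀ i, MeasurableSet (E i))
    {w : ι → ℝ} (hw : ∀ i ∈ s, 0 ≤ w i) (Y : ℝ) :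
    Y * P.real {ω | Y ≤ ∑ i ∈ s, (E i).indicator (fun _ => w i) ω} ≤
      ∑ i ∈ s, w i * P.real (E i) := by
  have hint : ∀ i ∈ s, Integrable ((E i).indicator fun _ => w i) P :=
    fun i _ => (integrable_const _).indicator (hE i)
  refine (mul_meas_ge_le_integral_of_nonneg ?_ (integrable_finsetSum s hint) Y).trans
    (le_of_eq ?_)
  · filter_upwards with ω
    exact Finset.sum_nonneg fun i hi => Set.indicator_nonneg (fun _ _ => hw i hi) ω
  · rw [integral_finsetSum s hint]
    refine Finset.sum_congr rfl fun i _ => ?_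
    rw [integral_indicator_const _ (hE i), smul_eq_mul, mul_comm]

section Structure

variable {V ι : Type*} [Fintype V] [DecidableEq V] [Fintype ι] (q : Sym2 V → unitInterval)
  {p : V → ℝ} {W : ℝ}

lemma explore_pure_weight_le {t : ι → V} {light : Finset V} {K : ℝ} (hlight : ∀ v ∈ light, p v ≤ K)
    {a : ι} (ha : p (t a) ≤ K) {G : SimpleGraph V} {i : ℕ} {u : V}
    (hu : u ∈ (explore t light G i).pure a) : p u ≤ K := by
  cases i with
  | zero =>
    have : u = t a := by simpa [explore] using hu
    rwa [this]
  | succ i => exact hlight u ((mem_explore_succ_pure t light).1 hu).1.1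

/-- The total weight of the vertices found within `l` steps has mean at most
`|ι| * K * ∑ i ≤ l, m ^ i`, where `m = (∑ v, p v ^ 2) / W`. -/
lemma edgeMeasure_volume_le (t : ι → V) (light : Finset V) (hp : ∀ v, 0 ≤ p v) (hW : 0 < W)
    (hq : ∀ u v, (q s(u, v) : ℝ) ≤ p u * p v / W) (l : ℕ) {K Y : ℝ} (ht : ∀ a, p (t a) ≤ K)
    (hY : 0 < Y) :
    (edgeMeasure q).real {G | ¬ ∑ v ∈ (explore t light G l).inner ∪ (explore t light G l).layer,
        p v ≤ Y} ≤
      Fintype.card ι * K * (∑ i ∈ Finset.range (l + 1), ((∑ v, p v ^ 2) / W) ^ i) / Y := by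
  set m := (∑ v, p v ^ 2) / W with hm
  set E : ι × V → Set (SimpleGraph V) := fun x => {G | G.edist (t x.1) x.2 ≤ l} with hE
  have hmark := mul_measureReal_le_sum_indicator (P := edgeMeasure q) (Finset.univ : Finset (ι × V))
    (E := E) (fun _ => .of_discrete) (w := fun x => p x.2) (fun x _ => hp x.2) Y
  rw [le_div_iff₀ hY, mul_comm]
  refine (mul_le_mul_of_nonneg_left (measureReal_mono ?_) hY.le).trans (hmark.trans ?_)
  · intro G hG
    rw [Set.mem_ofPred_eq, not_le] at hG
    rw [Set.mem_ofPred_eq, Fintype.sum_prod_type_right]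
    refine hG.le.trans ((Finset.sum_le_sum (g := fun v => ∑ a, (E (a, v)).indicator
      (fun _ => p v) G) fun v hv => ?_).trans (Finset.sum_le_univ_sum_of_nonneg fun v => ?_))
    · obtain ⟨a, ha⟩ := exists_edist_le_of_mem_explore t light hv
      have hnn : ∀ a ∈ Finset.univ, 0 ≤ (E (a, v)).indicator (fun _ => p v) G :=
        fun a _ => Set.indicator_nonneg (fun _ _ => hp v) G
      refine le_trans (le_of_eq ?_) (Finset.single_le_sum hnn (Finset.mem_univ a))
      rw [Set.indicator_of_mem (show G ∈ E (a, v) from ha)]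
    · exact Finset.sum_nonneg fun a _ => Set.indicator_nonneg (fun _ _ => hp v) G
  · rw [Fintype.sum_prod_type]
    have hrow : ∀ a, ∑ v, p v * (edgeMeasure q).real (E (a, v)) ≤
        K * ∑ i ∈ Finset.range (l + 1), m ^ i := by
      intro a
      have hm0 : 0 ≤ m := div_nonneg (Finset.sum_nonneg fun v _ => sq_nonneg _) hW.le
      have hle : ∀ v, p v * (edgeMeasure q).real (E (a, v)) ≤
          (if t a = v then p v else 0) +
            p v ^ 2 * (p (t a) / W * ∑ i ∈ Finset.range l, m ^ i) := by
        intro v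
        have hnn : 0 ≤ p v ^ 2 * (p (t a) / W * ∑ i ∈ Finset.range l, m ^ i) := by
          have := hp (t a)
          positivity
        split_ifs with h
        · have := mul_le_mul_of_nonneg_left
            (measureReal_le_one (μ := edgeMeasure q) (s := E (a, v))) (hp v)
          linarith
        · have := mul_le_mul_of_nonneg_left (edgeMeasure_edist_le q hp hW hq l h) (hp v)
          refine this.trans (le_of_eq ?_)
          rw [← hm]
          ring
      refine (Finset.sum_le_sum fun v _ => hle v).trans ?_
      rw [Finset.sum_add_distrib, Finset.sum_ite_eq, if_pos (Finset.mem_univ _), ← Finset.sum_mul,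
        Finset.sum_range_succ', pow_zero]
      have h1 : (∑ v, p v ^ 2) * (p (t a) / W * ∑ i ∈ Finset.range l, m ^ i) =
          p (t a) * ∑ i ∈ Finset.range l, m ^ (i + 1) := by
        rw [show ∑ v, p v ^ 2 = m * W by rw [hm, div_mul_cancel₀ _ hW.ne']]
        simp_rw [pow_succ]
        rw [← Finset.sum_mul]
        field_simp
      rw [h1, add_comm, ← mul_add_one]
      exact mul_le_mul_of_nonneg_right (ht a) (by positivity)
    refine (Finset.sum_le_sum fun a _ => hrow a).trans (le_of_eq ?_)
    rw [Finset.sum_const, Finset.card_univ, nsmul_eq_mul, mul_assoc]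

/-- With high probability the weight of the pure layer of the root `a` grows almost at the rate
`m`, as long as the total weight of the vertices found stays below `Y`. -/
lemma edgeMeasure_explore_growth {t : ι → V} {light : Finset V} {K K₁ K₂ Y ε m : ℝ}
    (hp : ∀ v, 0 < p v) (hW : 0 < W) (hq : ∀ u v, (q s(u, v) : ℝ) ≤ p u * p v / W)
    (hq' : ∀ u v, p u ≤ K₂ → p v ≤ K₂ → (q s(u, v) : ℝ) = p u * p v / W)
    (hlight : ∀ v ∈ light, p v ≤ K) (hKK : K ≤ K₂) (hK : 0 < K) (hK₁ : 0 < K₁)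
    (hsq : (1 - ε) * m * W ≤ ∑ v ∈ light, p v ^ 2) (hY : K * Y ≤ ε * W)
    (hε : 0 < ε) (hε1 : 4 * ε ≤ 1) (hm : 1 ≤ (1 - 4 * ε) * m) (a : ι) (h1 : K₁ ≤ p (t a))
    (h2 : p (t a) ≤ K₂) (i : ℕ) :
    (edgeMeasure q).real
      {G | ∑ v ∈ (explore t light G i).inner ∪ (explore t light G i).layer, p v ≤ Y ∧
        ∑ v ∈ (explore t light G i).pure a, p v < K₁ * ((1 - 4 * ε) * m) ^ i} ≤
      i * (K / (ε ^ 2 * K₁)) := by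
  classical
  have hm1 : 1 ≤ m := by
    by_contra h
    have : (1 - 4 * ε) * m ≤ 1 * m ∨ m < 0 := by
      rcases lt_or_ge m 0 with h | h
      · exact Or.inr h
      · exact Or.inl (mul_le_mul_of_nonneg_right (by linarith) h)
    rcases this with h' | h'
    · linarith
    · nlinarith
  have hδ : 0 ≤ K / (ε ^ 2 * K₁) := by positivity
  induction i with
  | zero =>
    have : {G : SimpleGraph V | ∑ v ∈ (explore t light G 0).inner ∪ (explore t light G 0).layer,
        p v ≤ Y ∧ ∑ v ∈ (explore t light G 0).pure a, p v < K₁ * ((1 - 4 * ε) * m) ^ 0} = ∅ := by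
      ext G
      simp [explore, h1]
    rw [this]
    simp
  | succ i ih =>
    set ρ := (1 - 4 * ε) * m with hρ
    set Q : Set (Exploration V ι) := {σ | ∑ v ∈ σ.inner ∪ σ.layer, p v ≤ Y ∧
      K₁ * ρ ^ i ≤ ∑ v ∈ σ.pure a, p v} with hQ
    set Bad : Exploration V ι → Set (SimpleGraph V) := fun σ =>
      {G | ∑ v ∈ light \ (σ.inner ∪ σ.layer), (attachedOnly (σ.pure a) σ.layer v).indicator
        (fun _ => p v) G < ρ * ∑ u ∈ σ.pure a, p u} with hBad
    have hsub : {G : SimpleGraph V |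
        ∑ v ∈ (explore t light G (i + 1)).inner ∪ (explore t light G (i + 1)).layer, p v ≤ Y ∧
          ∑ v ∈ (explore t light G (i + 1)).pure a, p v < K₁ * ρ ^ (i + 1)} ⊆
        {G | ∑ v ∈ (explore t light G i).inner ∪ (explore t light G i).layer, p v ≤ Y ∧
          ∑ v ∈ (explore t light G i).pure a, p v < K₁ * ρ ^ i} ∪
        {G | explore t light G i ∈ Q ∧ G ∈ Bad (explore t light G i)} := by
      rintro G ⟨hG1, hG2⟩
      have hvol : ∑ v ∈ (explore t light G i).inner ∪ (explore t light G i).layer, p v ≤ Y := by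
        refine le_trans (Finset.sum_le_sum_of_subset_of_nonneg ?_ fun v _ _ => (hp v).le) hG1
        rw [← explore_succ_inner]
        exact Finset.subset_union_left
      rcases lt_or_ge (∑ v ∈ (explore t light G i).pure a, p v) (K₁ * ρ ^ i) with h | h
      · exact Or.inl ⟨hvol, h⟩
      · refine Or.inr ⟨⟨hvol, h⟩, ?_⟩
        have hsum : ∑ v ∈ (explore t light G (i + 1)).pure a, p v =
            ∑ v ∈ light \ ((explore t light G i).inner ∪ (explore t light G i).layer),
              (attachedOnly ((explore t light G i).pure a) (explore t light G i).layer v).indicator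
                (fun _ => p v) G := by
          rw [explore, Exploration.next]
          simp only
          rw [Finset.sum_filter]
          refine Finset.sum_congr rfl fun v _ => ?_
          rw [Set.indicator_apply]
          exact if_congr Iff.rfl rfl rfl
        rw [hsum] at hG2
        rw [hBad, Set.mem_ofPred_eq]
        refine hG2.trans_le ?_
        rw [pow_succ']
        have := mul_le_mul_of_nonneg_left h (show 0 ≤ ρ by linarith)
        linarith
    refine (measureReal_mono hsub).trans ((measureReal_union_le _ _).trans ?_)
    push_cast
    rw [add_one_mul]
    refine add_le_add ih (edgeMeasure_explore_le t light q i Q hδ ?_ ?_)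
    · -- `Bad` only involves edges between the last layer and vertices not found so far.
      intro G _ G₁ G₂ h
      rw [hBad, Set.mem_ofPred_eq, Set.mem_ofPred_eq]
      have : ∀ v ∈ light \ ((explore t light G i).inner ∪ (explore t light G i).layer),
          (attachedOnly ((explore t light G i).pure a) (explore t light G i).layer v).indicator
              (fun _ => p v) G₁ =
            (attachedOnly ((explore t light G i).pure a) (explore t light G i).layer v).indicator
              (fun _ => p v) G₂ := by
        intro v hv
        have hiff := determinedOn_attachedOnly (explore_pure_subset t light G i a) v
          (G := G₁) (G' := G₂) (by
            rintro e ⟨u, hu, rfl⟩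
            refine h _ ?_
            rintro ⟨z, hz, hzu⟩
            rcases Sym2.mem_iff.1 hzu with rfl | rfl
            · exact Finset.disjoint_left.1 (explore_layer_disjoint t light G i) hz hu
            · exact (Finset.mem_sdiff.1 hv).2 (Finset.mem_union_left _ hz))
        simp only [Set.indicator_apply, hiff]
      rw [Finset.sum_congr rfl this]
    · rintro G ⟨hG1, hG2⟩
      have hw : K₁ ≤ ∑ u ∈ (explore t light G i).pure a, p u :=
        (le_mul_of_one_le_right hK₁.le (one_le_pow₀ hm)).trans hG2
      have hpure : ∀ u ∈ (explore t light G i).pure a, p u ≤ K₂ := fun u hu =>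
        explore_pure_weight_le (fun v hv => (hlight v hv).trans hKK) h2 hu
      have hLY : K * ∑ u ∈ (explore t light G i).layer, p u ≤ ε * W := by
        refine (mul_le_mul_of_nonneg_left ?_ hK.le).trans hY
        exact le_trans (Finset.sum_le_sum_of_subset_of_nonneg Finset.subset_union_right
          fun v _ _ => (hp v).le) hG1
      -- The vertices found so far carry only a small part of the sum of squares.
      have hrest : (1 - 2 * ε) * m * W ≤
          ∑ v ∈ light \ ((explore t light G i).inner ∪ (explore t light G i).layer), p v ^ 2 := by
        set B := (explore t light G i).inner ∪ (explore t light G i).layer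
        have h3 : ∑ v ∈ light ∩ B, p v ^ 2 ≤ ε * W := by
          calc ∑ v ∈ light ∩ B, p v ^ 2 ≤ ∑ v ∈ light ∩ B, K * p v := by
                refine Finset.sum_le_sum fun v hv => ?_
                rw [sq]
                exact mul_le_mul_of_nonneg_right (hlight v (Finset.mem_inter.1 hv).1) (hp v).le
            _ ≤ ∑ v ∈ B, K * p v := Finset.sum_le_sum_of_subset_of_nonneg
                Finset.inter_subset_right fun v _ _ => mul_nonneg hK.le (hp v).le
            _ ≤ K * Y := by
                rw [← Finset.mul_sum]
                exact mul_le_mul_of_nonneg_left hG1 hK.le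
            _ ≤ _ := hY
        have h4 := Finset.sum_inter_add_sum_sdiff light B fun v => p v ^ 2
        have h5 : ε * W ≤ ε * (m * W) := by
          refine mul_le_mul_of_nonneg_left ?_ hε.le
          exact le_mul_of_one_le_left hW.le hm1
        linarith
      have hgrow := edgeMeasure_growth q (F := (explore t light G i).pure a) hp hW hq
        (fun u hu v hv => hq' u v (hpure u hu) ((hlight v hv).trans hKK))
        (explore_pure_subset t light G i a) Finset.subset_union_right
        (by
          rw [Finset.nonempty_iff_ne_empty]
          intro h
          rw [h, Finset.sum_empty] at hw
          linarith) hlight hLY hrest (by linarith) hε hε1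
      refine hgrow.trans ?_
      have h6 : K₁ ≤ (1 - 3 * ε) * m * ∑ u ∈ (explore t light G i).pure a, p u := by
        have h7 : 1 ≤ (1 - 3 * ε) * m := by nlinarith
        nlinarith
      gcongr

end Structure

/-! ### The distances between two families of roots carry much information -/

section Far

variable {V α : Type*} [Fintype V] [DecidableEq V] [Fintype α] (q : Sym2 V → unitInterval)
  {p : V → ℝ} {W : ℝ}

open Classical in
/-- The pairs consisting of a root of the first and a root of the second family that are declared
to be far apart and whose pure layers both have weight at least `Z`. -/
noncomputable def heavyFarPairs (p : V → ℝ) (Z : ℝ) (Far : α → α → Prop)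
    (σ : Exploration V (α × Bool)) : Finset (α × α) :=
  Finset.univ.filter fun x => Far x.1 x.2 ∧ Z ≤ ∑ v ∈ σ.pure (x.1, true), p v ∧
    Z ≤ ∑ v ∈ σ.pure (x.2, false), p v

/-- The expected number of edges between heavy pure layers that are declared to be far apart. -/
lemma heavyFarPairs_sum_le (hp : ∀ v, 0 < p v) (hW : 0 < W) {Z : ℝ} (hZ : 0 ≤ Z)
    {Far : α → α → Prop} {σ : Exploration V (α × Bool)} {J : Finset ((α × α) × V × V)}
    (hJ : ∀ x, x ∈ J ↔ Far x.1.1 x.1.2 ∧ x.2.1 ∈ σ.pure (x.1.1, true) ∧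
      x.2.2 ∈ σ.pure (x.1.2, false)) :
    (heavyFarPairs p Z Far σ).card * (Z ^ 2 / W) ≤ ∑ x ∈ J, p x.2.1 * p x.2.2 / W := by
  classical
  have hnn : ∀ u v, 0 ≤ p u * p v / W := fun u v =>
    div_nonneg (mul_nonneg (hp u).le (hp v).le) hW.le
  set T := heavyFarPairs p Z Far σ with hT
  calc (T.card : ℝ) * (Z ^ 2 / W) = ∑ x ∈ T, Z ^ 2 / W := by
        rw [Finset.sum_const, nsmul_eq_mul]
    _ ≤ ∑ x ∈ T, ∑ y ∈ σ.pure (x.1, true) ×ˢ σ.pure (x.2, false), p y.1 * p y.2 / W := by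
        refine Finset.sum_le_sum fun x hx => ?_
        obtain ⟨_, h1, h2⟩ := (Finset.mem_filter.1 hx).2
        rw [← Finset.sum_div, Finset.sum_product, ← Finset.sum_mul_sum, sq]
        have := mul_le_mul h1 h2 hZ (hZ.trans h1)
        gcongr
    _ ≤ ∑ x ∈ T, ∑ y : V × V, if (x, y) ∈ J then p y.1 * p y.2 / W else 0 := by
        refine Finset.sum_le_sum fun x hx => ?_
        rw [← Finset.sum_filter]
        refine Finset.sum_le_sum_of_subset_of_nonneg (fun y hy => ?_) fun y _ _ => hnn _ _
        obtain ⟨h3, h4⟩ := Finset.mem_product.1 hy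
        rw [Finset.mem_filter, hJ]
        exact ⟨Finset.mem_univ _, (Finset.mem_filter.1 hx).2.1, h3, h4⟩
    _ ≤ ∑ x : α × α, ∑ y : V × V, if (x, y) ∈ J then p y.1 * p y.2 / W else 0 := by
        refine Finset.sum_le_univ_sum_of_nonneg fun x => Finset.sum_nonneg fun y _ => ?_
        split_ifs
        · exact hnn _ _
        · exact le_rfl
    _ = ∑ x ∈ J, p x.2.1 * p x.2.2 / W := by
        rw [← Fintype.sum_prod_type', ← Finset.sum_filter, Finset.filter_univ_mem]

/-- If many pairs of heavy pure layers are declared to be far apart, it is very unlikely that these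
pairs of roots are indeed far apart: no edge between two such layers may be present, and these edges
have not been looked at in the exploration. -/
lemma edgeMeasure_far_le {t : α × Bool → V} (ht : Function.Injective t) {light : Finset V}
    {K₂ Z : ℝ} (hp : ∀ v, 0 < p v) (hW : 0 < W)
    (hq' : ∀ u v, p u ≤ K₂ → p v ≤ K₂ → (q s(u, v) : ℝ) = p u * p v / W)
    (hlight : ∀ v ∈ light, p v ≤ K₂) (htK : ∀ a, p (t a) ≤ K₂) (hZ : 0 ≤ Z) (l : ℕ)
    (Far : α → α → Prop) (N : ℝ) :
    (edgeMeasure q).real {G | N ≤ (heavyFarPairs p Z Far (explore t light G l)).card ∧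
        ∀ a b, Far a b → ¬ G.edist (t (a, true)) (t (b, false)) ≤ (2 * l + 1 : ℕ)} ≤
      Real.exp (-(N * Z ^ 2 / W)) := by
  classical
  obtain ⟨J, hJ⟩ : ∃ J : Exploration V (α × Bool) → Finset ((α × α) × V × V), ∀ σ x, x ∈ J σ ↔
      Far x.1.1 x.1.2 ∧ x.2.1 ∈ σ.pure (x.1.1, true) ∧ x.2.2 ∈ σ.pure (x.1.2, false) :=
    ⟨fun σ => Finset.univ.filter fun x => Far x.1.1 x.1.2 ∧ x.2.1 ∈ σ.pure (x.1.1, true) ∧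
      x.2.2 ∈ σ.pure (x.1.2, false), fun σ x => by simp⟩
  obtain ⟨U, hU⟩ : ∃ U : Exploration V (α × Bool) → Finset (Sym2 V),
      ∀ σ, U σ = (J σ).image fun x => s(x.2.1, x.2.2) := ⟨_, fun σ => rfl⟩
  set Q : Set (Exploration V (α × Bool)) := {σ | N ≤ (heavyFarPairs p Z Far σ).card} with hQ
  have hsub : {G : SimpleGraph V | N ≤ (heavyFarPairs p Z Far (explore t light G l)).card ∧
      ∀ a b, Far a b → ¬ G.edist (t (a, true)) (t (b, false)) ≤ (2 * l + 1 : ℕ)} ⊆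
      {G | explore t light G l ∈ Q ∧
        G ∈ {G : SimpleGraph V | ∀ e ∈ U (explore t light G l), e ∉ G.edgeSet}} := by
    rintro G ⟨h1, h2⟩
    refine ⟨h1, fun e he h => ?_⟩
    obtain ⟨⟨⟨a, b⟩, u, v⟩, hx, rfl⟩ := Finset.mem_image.1 (hU _ ▸ he)
    obtain ⟨hfar, hu, hv⟩ := (hJ _ _).1 hx
    refine h2 a b hfar ?_
    have hu' := edist_le_of_mem_explore_pure t light hu
    have hv' := edist_le_of_mem_explore_pure t light hv
    rw [SimpleGraph.edist_comm] at hv'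
    have h3 := SimpleGraph.edist_eq_one_iff_adj.2 h
    calc G.edist (t (a, true)) (t (b, false)) ≤ G.edist (t (a, true)) u + G.edist u (t (b, false)) :=
          SimpleGraph.edist_triangle
      _ ≤ G.edist (t (a, true)) u + (G.edist u v + G.edist v (t (b, false))) := by
          gcongr
          exact SimpleGraph.edist_triangle
      _ ≤ l + (1 + l) := add_le_add hu' (add_le_add h3.le hv')
      _ = (2 * l + 1 : ℕ) := by
          push_cast
          ring
  refine (measureReal_mono hsub).trans ?_
  refine edgeMeasure_explore_le t light q l Q
    (B := fun σ => {G : SimpleGraph V | ∀ e ∈ U σ, e ∉ G.edgeSet}) (Real.exp_pos _).le ?_ ?_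
  · intro G _ G₁ G₂ h
    refine forall_congr' fun e => imp_congr_right fun he => not_congr (h e ?_)
    obtain ⟨⟨⟨a, b⟩, u, v⟩, hx, rfl⟩ := Finset.mem_image.1 (hU _ ▸ he)
    obtain ⟨hfar, hu, hv⟩ := (hJ _ _).1 hx
    have hdis := Finset.disjoint_left.1 (explore_layer_disjoint t light G l)
    rintro ⟨z, hz, hzu⟩
    rcases Sym2.mem_iff.1 hzu with rfl | rfl
    · exact hdis hz (explore_pure_subset t light G l _ hu)
    · exact hdis hz (explore_pure_subset t light G l _ hv)
  · intro G hG
    set σ := explore t light G l with hσ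
    have hdis : ∀ {a b : α × Bool} {u : V}, u ∈ σ.pure a → u ∈ σ.pure b → a = b := by
      intro a b u ha hb
      by_contra hab
      exact Finset.disjoint_left.1 (explore_pure_disjoint t light ht G l hab) ha hb
    have hinj : Set.InjOn (fun x : (α × α) × V × V => s(x.2.1, x.2.2)) (J σ) := by
      rintro ⟨⟨a, b⟩, u, v⟩ hx ⟨⟨a', b'⟩, u', v'⟩ hx' h
      obtain ⟨_, hu, hv⟩ := (hJ _ _).1 (Finset.mem_coe.1 hx)
      obtain ⟨_, hu', hv'⟩ := (hJ _ _).1 (Finset.mem_coe.1 hx')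
      simp only at hu hv hu' hv' h
      rcases Sym2.eq_iff.1 h with ⟨rfl, rfl⟩ | ⟨rfl, rfl⟩
      · have h1 := hdis hu hu'
        have h2 := hdis hv hv'
        simp only [Prod.mk.injEq, and_true] at h1 h2
        rw [h1, h2]
      · have h1 := hdis hu hv'
        simp at h1
    have hdiag : ∀ e ∈ U σ, ¬ e.IsDiag := by
      intro e he
      obtain ⟨⟨⟨a, b⟩, u, v⟩, hx, rfl⟩ := Finset.mem_image.1 (hU _ ▸ he)
      obtain ⟨hfar, hu, hv⟩ := (hJ _ _).1 hx
      rw [Sym2.mk_isDiag_iff]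
      simp only at hu hv ⊢
      rintro rfl
      have h1 := hdis hu hv
      simp at h1
    rw [edgeMeasure_no_edge q hdiag]
    refine (prod_one_sub_le_exp _ fun e _ => (q e).2.2).trans (Real.exp_le_exp.2 (neg_le_neg ?_))
    rw [hU σ, Finset.sum_image hinj]
    have hval : ∀ x ∈ J σ, (q s(x.2.1, x.2.2) : ℝ) = p x.2.1 * p x.2.2 / W := by
      intro x hx
      obtain ⟨_, hu, hv⟩ := (hJ _ _).1 hx
      exact hq' _ _ (explore_pure_weight_le hlight (htK _) hu)
        (explore_pure_weight_le hlight (htK _) hv)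
    rw [Finset.sum_congr rfl hval]
    calc N * Z ^ 2 / W ≤ (heavyFarPairs p Z Far σ).card * (Z ^ 2 / W) := by
          rw [mul_div_assoc]
          exact mul_le_mul_of_nonneg_right hG (by positivity)
      _ ≤ _ := heavyFarPairs_sum_le hp hW hZ (hJ σ)

end Far

/-! ### Counting labelings -/

/-- The families of labels of total length at most `B` form a finite set with at most
`2 ^ |ι| * 4 ^ B` elements. -/
lemma exists_finset_labelings (ι : Type*) [Fintype ι] (B : ℕ) :
    ∃ S : Finset (ι → List Bool), (∀ L, totalLength L ≤ B → L ∈ S) ∧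
      (S.card : ℝ) ≤ 2 ^ Fintype.card ι * 4 ^ B := by
  classical
  -- Each label of length `k` gets the weight `4 ^ (-k)`; the weights of all labels add up to `2`.
  have hfin : {w : List Bool | w.length ≤ B}.Finite := List.finite_length_le Bool B
  set A := hfin.toFinset with hA
  have hwt : ∑ w ∈ A, ((4 : ℝ) ^ w.length)⁻¹ ≤ 2 := by
    have hsub : A ⊆ (Finset.range (B + 1)).biUnion
        fun k => (Finset.univ : Finset (Fin k → Bool)).image List.ofFn := by
      intro w hw
      have hw' : w.length ≤ B := by simpa [hA] using hw
      rw [Finset.mem_biUnion]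
      exact ⟨w.length, Finset.mem_range.2 (by omega),
        Finset.mem_image.2 ⟨w.get, Finset.mem_univ _, List.ofFn_get w⟩⟩
    calc ∑ w ∈ A, ((4 : ℝ) ^ w.length)⁻¹ ≤ ∑ w ∈ (Finset.range (B + 1)).biUnion
          fun k => (Finset.univ : Finset (Fin k → Bool)).image List.ofFn,
            ((4 : ℝ) ^ w.length)⁻¹ :=
          Finset.sum_le_sum_of_subset_of_nonneg hsub fun _ _ _ => by positivity
      _ ≤ ∑ k ∈ Finset.range (B + 1), ∑ w ∈ (Finset.univ : Finset (Fin k → Bool)).image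
            List.ofFn, ((4 : ℝ) ^ w.length)⁻¹ := by
          rw [Finset.sum_biUnion]
          intro k _ k' _ hkk
          rw [Function.onFun, Finset.disjoint_left]
          intro w hw hw'
          obtain ⟨x, _, rfl⟩ := Finset.mem_image.1 hw
          obtain ⟨y, _, hy⟩ := Finset.mem_image.1 hw'
          have := congrArg List.length hy
          simp only [List.length_ofFn] at this
          exact hkk this.symm
      _ = ∑ k ∈ Finset.range (B + 1), ((1 : ℝ) / 2) ^ k := by
          refine Finset.sum_congr rfl fun k _ => ?_
          rw [Finset.sum_image List.ofFn_injective.injOn]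
          simp only [List.length_ofFn, Finset.sum_const, Finset.card_univ, Fintype.card_fun,
            Fintype.card_bool, Fintype.card_fin, nsmul_eq_mul]
          rw [← div_eq_mul_inv, Nat.cast_pow, Nat.cast_ofNat, ← div_pow]
          norm_num
      _ ≤ 2 := by
          have := geom_sum_eq (show (1 : ℝ) / 2 ≠ 1 by norm_num) (B + 1)
          rw [this]
          have h0 : (0 : ℝ) ≤ (1 / 2) ^ (B + 1) := by positivity
          rw [div_le_iff_of_neg (by norm_num)]
          linarith
  refine ⟨(Fintype.piFinset fun _ => A).filter fun L => totalLength L ≤ B, ?_, ?_⟩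
  · intro L hL
    rw [Finset.mem_filter, Fintype.mem_piFinset]
    refine ⟨fun x => ?_, hL⟩
    rw [hA, Set.Finite.mem_toFinset]
    exact (Finset.single_le_sum (f := fun x => (L x).length) (fun _ _ => Nat.zero_le _)
      (Finset.mem_univ x)).trans hL
  · set S := (Fintype.piFinset fun _ : ι => A).filter fun L => totalLength L ≤ B with hS
    have h1 : (S.card : ℝ) * ((4 : ℝ) ^ B)⁻¹ ≤ 2 ^ Fintype.card ι := by
      calc (S.card : ℝ) * ((4 : ℝ) ^ B)⁻¹ = ∑ L ∈ S, ((4 : ℝ) ^ B)⁻¹ := by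
            rw [Finset.sum_const, nsmul_eq_mul]
        _ ≤ ∑ L ∈ S, ∏ x, ((4 : ℝ) ^ (L x).length)⁻¹ := by
            refine Finset.sum_le_sum fun L hL => ?_
            rw [Finset.prod_inv_distrib, Finset.prod_pow_eq_pow_sum]
            refine inv_anti₀ (by positivity) (pow_le_pow_right₀ (by norm_num) ?_)
            exact (Finset.mem_filter.1 hL).2
        _ ≤ ∑ L ∈ Fintype.piFinset fun _ : ι => A, ∏ x, ((4 : ℝ) ^ (L x).length)⁻¹ :=
            Finset.sum_le_sum_of_subset_of_nonneg (Finset.filter_subset _ _)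
              fun _ _ _ => by positivity
        _ = ∏ _x : ι, ∑ w ∈ A, ((4 : ℝ) ^ w.length)⁻¹ := by
            rw [Finset.prod_univ_sum]
        _ ≤ 2 ^ Fintype.card ι := by
            rw [Finset.prod_const, Finset.card_univ]
            exact pow_le_pow_left₀ (Finset.sum_nonneg fun _ _ => by positivity) hwt _
    rwa [← div_eq_mul_inv, div_le_iff₀ (by positivity)] at h1

/-! ### Short labels of a group of terminals -/

lemma measureReal_card_filter_le {Ω ι : Type*} [MeasurableSpace Ω] {P : Measure Ω}
    [IsProbabilityMeasure P] [Fintype ι] {E : ι → Set Ω}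
    [∀ ω, DecidablePred fun i => ω ∈ E i] (hE : ∀ i, MeasurableSet (E i))
    {δ Y : ℝ} (hδ : ∀ i, P.real (E i) ≤ δ) (hY : 0 < Y) :
    P.real {ω | Y ≤ (Finset.univ.filter fun i => ω ∈ E i).card} ≤ Fintype.card ι * δ / Y := by
  have h := mul_measureReal_le_sum_indicator (P := P) Finset.univ hE (w := fun _ => 1)
    (fun _ _ => zero_le_one) Y
  rw [le_div_iff₀ hY, mul_comm]
  have hset : {ω | Y ≤ (Finset.univ.filter fun i => ω ∈ E i).card} =
      {ω | Y ≤ ∑ i, (E i).indicator (fun _ => (1 : ℝ)) ω} := by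
    ext ω
    simp only [Set.mem_ofPred_eq, Finset.card_filter, Nat.cast_sum, Nat.cast_ite, Nat.cast_one,
      Nat.cast_zero]
    refine Iff.of_eq (congrArg (Y ≤ ·) (Finset.sum_congr rfl fun i _ => ?_))
    split_ifs with h
    · rw [Set.indicator_of_mem h]
    · rw [Set.indicator_of_notMem h]
  rw [hset]
  refine h.trans ?_
  calc ∑ i, 1 * P.real (E i) ≤ ∑ _i : ι, δ :=
        Finset.sum_le_sum fun i _ => by rw [one_mul]; exact hδ i
    _ = _ := by rw [Finset.sum_const, Finset.card_univ, nsmul_eq_mul]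

/-- If few pairs are near and few roots are light, at least half of all pairs are far apart and have
heavy pure layers. -/
lemma le_card_heavyFarPairs {V α : Type*} [Fintype α] {p : V → ℝ} {Z : ℝ} {Far : α → α → Prop}
    {σ : Exploration V (α × Bool)} {N : Finset (α × α)} {A : Finset (α × Bool)}
    (hN : ∀ x, ¬ Far x.1 x.2 → x ∈ N) (hA : ∀ x, ∑ v ∈ σ.pure x, p v < Z → x ∈ A)
    (hN4 : (N.card : ℝ) ≤ (Fintype.card α : ℝ) ^ 2 / 4)
    (hA8 : (A.card : ℝ) ≤ (Fintype.card α : ℝ) / 8) :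
    (Fintype.card α : ℝ) ^ 2 / 2 ≤ (heavyFarPairs p Z Far σ).card := by
  classical
  set A₁ : Finset α := Finset.univ.filter fun a => (a, true) ∈ A with hA₁
  set A₂ : Finset α := Finset.univ.filter fun a => (a, false) ∈ A with hA₂
  have h1 : A₁.card ≤ A.card := Finset.card_le_card_of_injOn (fun a => (a, true))
    (fun a ha => (Finset.mem_filter.1 ha).2) (fun a _ b _ h => by simpa using h)
  have h2 : A₂.card ≤ A.card := Finset.card_le_card_of_injOn (fun a => (a, false))
    (fun a ha => (Finset.mem_filter.1 ha).2) (fun a _ b _ h => by simpa using h)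
  have hcov : (Finset.univ : Finset (α × α)) ⊆
      heavyFarPairs p Z Far σ ∪ (N ∪ (A₁ ×ˢ Finset.univ ∪ Finset.univ ×ˢ A₂)) := by
    rintro ⟨a, b⟩ _
    by_cases hf : Far a b
    · rcases lt_or_ge (∑ v ∈ σ.pure (a, true), p v) Z with ha | ha
      · simp [hA₁, hA _ ha]
      · rcases lt_or_ge (∑ v ∈ σ.pure (b, false), p v) Z with hb | hb
        · simp [hA₂, hA _ hb]
        · simp [heavyFarPairs, hf, ha, hb]
    · simp [hN (a, b) hf]
  have hcard := Finset.card_le_card hcov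
  have h3 := hcard.trans ((Finset.card_union_le _ _).trans (Nat.add_le_add_left
    ((Finset.card_union_le _ _).trans (Nat.add_le_add_left (Finset.card_union_le _ _) _)) _))
  rw [Finset.card_univ, Fintype.card_prod, Finset.card_product, Finset.card_product,
    Finset.card_univ] at h3
  have h4 : (Fintype.card α : ℝ) * Fintype.card α ≤ (heavyFarPairs p Z Far σ).card +
      (N.card + (A₁.card * Fintype.card α + Fintype.card α * A₂.card)) := by exact_mod_cast h3
  have h5 : (A₁.card : ℝ) ≤ (Fintype.card α : ℝ) / 8 := le_trans (by exact_mod_cast h1) hA8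
  have h6 : (A₂.card : ℝ) ≤ (Fintype.card α : ℝ) / 8 := le_trans (by exact_mod_cast h2) hA8
  have h0 : (0 : ℝ) ≤ Fintype.card α := Nat.cast_nonneg _
  nlinarith [mul_le_mul_of_nonneg_right h5 h0, mul_le_mul_of_nonneg_left h6 h0]

section Group

variable {V α : Type*} [Fintype V] [DecidableEq V] [Fintype α] (q : Sym2 V → unitInterval)
  {p : V → ℝ} {W : ℝ}

/-- It is unlikely that the mutual distances of the roots `t` can be recovered from short labels:
the four terms bound the probabilities that the exploration finds too many vertices, that too many
pairs of roots are near to each other, that too many pure layers are light, and that one of the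
few short labelings is correct although none of these three exceptions occurs. -/
lemma edgeMeasure_short_labels_le [Nonempty α] {t : α × Bool → V} (ht : Function.Injective t)
    {light : Finset V} {K K₁ K₂ Y ε m : ℝ}
    (hp : ∀ v, 0 < p v) (hW : 0 < W) (hq : ∀ u v, (q s(u, v) : ℝ) ≤ p u * p v / W)
    (hq' : ∀ u v, p u ≤ K₂ → p v ≤ K₂ → (q s(u, v) : ℝ) = p u * p v / W)
    (hm : m = (∑ v, p v ^ 2) / W)
    (hlight : ∀ v ∈ light, p v ≤ K) (hKK : K ≤ K₂) (hK : 0 < K) (hK₁ : 0 < K₁)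
    (hsq : (1 - ε) * m * W ≤ ∑ v ∈ light, p v ^ 2) (hY0 : 0 < Y) (hY : K * Y ≤ ε * W)
    (hε : 0 < ε) (hε1 : 4 * ε ≤ 1) (hρ : 1 ≤ (1 - 4 * ε) * m)
    (h1 : ∀ a, K₁ ≤ p (t a)) (h2 : ∀ a, p (t a) ≤ K₂) (l B : ℕ)
    (D : List Bool → List Bool → ℕ∞) :
    (edgeMeasure q).real {G | ∃ L : α × Bool → List Bool, totalLength L ≤ B ∧
        ∀ x y, D (L x) (L y) = G.edist (t x) (t y)} ≤
      2 * Fintype.card α * K₂ * (∑ i ∈ Finset.range (l + 1), m ^ i) / Y +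
      4 * (K₂ ^ 2 / W * ∑ i ∈ Finset.range (2 * l + 1), m ^ i) +
      16 * (l * (K / (ε ^ 2 * K₁))) +
      2 ^ (2 * Fintype.card α) * 4 ^ B * Real.exp
        (-((Fintype.card α : ℝ) ^ 2 / 2 * (K₁ * ((1 - 4 * ε) * m) ^ l) ^ 2 / W)) := by
  classical
  set P := edgeMeasure q with hP
  set Z := K₁ * ((1 - 4 * ε) * m) ^ l with hZ
  have hZ0 : 0 ≤ Z := mul_nonneg hK₁.le (pow_nonneg (by linarith) _)
  have hs : (0 : ℝ) < Fintype.card α := by exact_mod_cast Fintype.card_pos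
  set vol : SimpleGraph V → ℝ := fun G =>
    ∑ v ∈ (explore t light G l).inner ∪ (explore t light G l).layer, p v with hvol
  set near : α × α → Set (SimpleGraph V) := fun x =>
    {G | G.edist (t (x.1, true)) (t (x.2, false)) ≤ (2 * l + 1 : ℕ)} with hnear
  set thin : α × Bool → Set (SimpleGraph V) := fun x =>
    {G | vol G ≤ Y ∧ ∑ v ∈ (explore t light G l).pure x, p v < Z} with hthin
  set E₁ : Set (SimpleGraph V) := {G | ¬ vol G ≤ Y} with hE₁
  set E₂ : Set (SimpleGraph V) := {G | (Fintype.card α : ℝ) ^ 2 / 4 ≤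
    (Finset.univ.filter fun x => G ∈ near x).card} with hE₂
  set E₃ : Set (SimpleGraph V) := {G | (Fintype.card α : ℝ) / 8 ≤
    (Finset.univ.filter fun x => G ∈ thin x).card} with hE₃
  obtain ⟨S, hS, hScard⟩ := exists_finset_labelings (α × Bool) B
  set E₄ : (α × Bool → List Bool) → Set (SimpleGraph V) := fun L =>
    {G | (Fintype.card α : ℝ) ^ 2 / 2 ≤ (heavyFarPairs p Z
        (fun a b => ¬ D (L (a, true)) (L (b, false)) ≤ (2 * l + 1 : ℕ)) (explore t light G l)).card ∧
      ∀ a b, ¬ D (L (a, true)) (L (b, false)) ≤ (2 * l + 1 : ℕ) →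
        ¬ G.edist (t (a, true)) (t (b, false)) ≤ (2 * l + 1 : ℕ)} with hE₄
  have hsub : {G : SimpleGraph V | ∃ L : α × Bool → List Bool, totalLength L ≤ B ∧
      ∀ x y, D (L x) (L y) = G.edist (t x) (t y)} ⊆ E₁ ∪ E₂ ∪ E₃ ∪ ⋃ L ∈ S, E₄ L := by
    rintro G ⟨L, hLB, hL⟩
    by_cases hG1 : G ∈ E₁
    · exact Or.inl (Or.inl (Or.inl hG1))
    by_cases hG2 : G ∈ E₂
    · exact Or.inl (Or.inl (Or.inr hG2))
    by_cases hG3 : G ∈ E₃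
    · exact Or.inl (Or.inr hG3)
    refine Or.inr (Set.mem_biUnion (x := L) (hS L hLB) ⟨?_, fun a b h => ?_⟩)
    · rw [hE₂, Set.mem_ofPred_eq, not_le] at hG2
      rw [hE₃, Set.mem_ofPred_eq, not_le] at hG3
      rw [hE₁, Set.mem_ofPred_eq, not_not] at hG1
      refine le_card_heavyFarPairs (N := Finset.univ.filter fun x => G ∈ near x)
        (A := Finset.univ.filter fun x => G ∈ thin x) ?_ ?_ hG2.le hG3.le
      · intro x hx
        rw [not_not, hL] at hx
        exact Finset.mem_filter.2 ⟨Finset.mem_univ _, hx⟩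
      · intro x hx
        exact Finset.mem_filter.2 ⟨Finset.mem_univ _, hG1, hx⟩
    · rwa [hL] at h
  have hP1 : P.real E₁ ≤ 2 * Fintype.card α * K₂ * (∑ i ∈ Finset.range (l + 1), m ^ i) / Y := by
    have := edgeMeasure_volume_le q t light (fun v => (hp v).le) hW hq l h2 hY0
    rw [Fintype.card_prod, Fintype.card_bool, ← hm] at this
    push_cast at this
    rwa [mul_comm (Fintype.card α : ℝ) 2] at this
  have hP2 : P.real E₂ ≤ 4 * (K₂ ^ 2 / W * ∑ i ∈ Finset.range (2 * l + 1), m ^ i) := by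
    have hm0 : 0 ≤ m := hm ▸ div_nonneg (Finset.sum_nonneg fun v _ => sq_nonneg _) hW.le
    have hδ : ∀ x, P.real (near x) ≤ K₂ ^ 2 / W * ∑ i ∈ Finset.range (2 * l + 1), m ^ i := by
      intro x
      have hne : t (x.1, true) ≠ t (x.2, false) := fun h => by simpa using ht h
      refine (edgeMeasure_edist_le q (fun v => (hp v).le) hW hq (2 * l + 1) hne).trans ?_
      rw [← hm]
      have := mul_le_mul (h2 (x.1, true)) (h2 (x.2, false)) (hp _).le
        ((hp _).le.trans (h2 (x.1, true)))
      rw [sq]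
      gcongr
    refine (measureReal_card_filter_le (P := P) (Y := (Fintype.card α : ℝ) ^ 2 / 4)
      (fun _ => .of_discrete) hδ (by positivity)).trans
      (le_of_eq ?_)
    rw [Fintype.card_prod]
    push_cast
    field_simp
  have hP3 : P.real E₃ ≤ 16 * (l * (K / (ε ^ 2 * K₁))) := by
    have hδ : ∀ x, P.real (thin x) ≤ l * (K / (ε ^ 2 * K₁)) := fun x =>
      edgeMeasure_explore_growth q hp hW hq hq' hlight hKK hK hK₁ hsq hY hε hε1 hρ x (h1 x) (h2 x) l
    refine (measureReal_card_filter_le (P := P) (Y := (Fintype.card α : ℝ) / 8)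
      (fun _ => .of_discrete) hδ (by positivity)).trans
      (le_of_eq ?_)
    rw [Fintype.card_prod, Fintype.card_bool]
    push_cast
    field_simp
    ring
  have hP4 : P.real (⋃ L ∈ S, E₄ L) ≤ 2 ^ (2 * Fintype.card α) * 4 ^ B * Real.exp
      (-((Fintype.card α : ℝ) ^ 2 / 2 * Z ^ 2 / W)) := by
    refine (measureReal_biUnion_finset_le _ _).trans ?_
    refine (Finset.sum_le_sum fun L _ => edgeMeasure_far_le q ht hp hW hq'
      (fun v hv => (hlight v hv).trans hKK) h2 hZ0 l _ _).trans ?_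
    rw [Finset.sum_const, nsmul_eq_mul]
    refine mul_le_mul_of_nonneg_right ?_ (Real.exp_pos _).le
    rwa [Fintype.card_prod, Fintype.card_bool, mul_comm (Fintype.card α)] at hScard
  calc P.real _ ≤ P.real (E₁ ∪ E₂ ∪ E₃ ∪ ⋃ L ∈ S, E₄ L) := measureReal_mono hsub
    _ ≤ P.real E₁ + P.real E₂ + P.real E₃ + P.real (⋃ L ∈ S, E₄ L) := by
        refine (measureReal_union_le _ _).trans (add_le_add_left ?_ _)
        refine (measureReal_union_le _ _).trans (add_le_add_left ?_ _)
        exact measureReal_union_le _ _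
    _ ≤ _ := by linarith

end Group

/-! ### From groups of terminals to all labels -/

/-- If short labels are unlikely to recover the distances within any given group of `2 * s`
terminals from `T`, then the total length of all labels is unlikely to be small: otherwise at least
half of `g` disjoint groups would have short labels. -/
lemma edgeMeasure_totalLength_lt_le {V : Type*} [Fintype V] [DecidableEq V]
    (q : Sym2 V → unitInterval) {T : Finset V} {s g B : ℕ} (hg : 0 < g)
    (hgT : g * (2 * s) ≤ T.card) {η : ℝ} (D : List Bool → List Bool → ℕ∞)
    (hη : ∀ t : Fin s × Bool → V, Function.Injective t → (∀ a, t a ∈ T) →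
      (edgeMeasure q).real {G | ∃ L : Fin s × Bool → List Bool, totalLength L ≤ B ∧
        ∀ x y, D (L x) (L y) = G.edist (t x) (t y)} ≤ η) :
    (edgeMeasure q).real {G | ∃ L : V → List Bool, RecoversDistances D G L ∧
      2 * totalLength L < g * (B + 1)} ≤ 2 * η := by
  classical
  obtain ⟨e⟩ : Nonempty (Fin g × (Fin s × Bool) ↪ T) := by
    apply Function.Embedding.nonempty_of_card_le
    simp only [Fintype.card_prod, Fintype.card_fin, Fintype.card_bool, Fintype.card_coe]
    rwa [mul_comm s 2]
  set t : Fin g → Fin s × Bool → V := fun j a => e (j, a) with ht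
  set E : Fin g → Set (SimpleGraph V) := fun j =>
    {G | ∃ L : Fin s × Bool → List Bool, totalLength L ≤ B ∧
        ∀ x y, D (L x) (L y) = G.edist (t j x) (t j y)} with hE
  have hδ : ∀ j, (edgeMeasure q).real (E j) ≤ η := fun j => hη (t j)
    (fun a b h => by simpa using e.injective (Subtype.ext h)) fun a => (e (j, a)).2
  have hg' : (0 : ℝ) < g := by exact_mod_cast hg
  have h := measureReal_card_filter_le (P := edgeMeasure q) (Y := (g : ℝ) / 2)
    (fun _ => .of_discrete) hδ (by positivity)
  rw [Fintype.card_fin] at h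
  refine (measureReal_mono ?_).trans (h.trans (le_of_eq (by field_simp)))
  rintro G ⟨L, hL, hlt⟩
  rw [Set.mem_ofPred_eq]
  set N := Finset.univ.filter fun j => G ∈ E j with hN
  have hsum : ∑ j, totalLength (fun a => L (t j a)) ≤ totalLength L := by
    calc ∑ j, totalLength (fun a => L (t j a)) =
          ∑ x : Fin g × (Fin s × Bool), (L (e x)).length := by
          rw [Fintype.sum_prod_type]
          rfl
      _ = ∑ v ∈ Finset.univ.image (fun x => (e x : V)), (L v).length := by
          rw [Finset.sum_image]
          exact fun x _ y _ h => e.injective (Subtype.ext h)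
      _ ≤ totalLength L := Finset.sum_le_univ_sum_of_nonneg fun _ => Nat.zero_le _
  have hlong : (Finset.univ.filter fun j => G ∉ E j).card * (B + 1) ≤ totalLength L := by
    refine le_trans ?_ hsum
    rw [← smul_eq_mul, ← Finset.sum_const]
    refine (Finset.sum_le_sum fun j hj => ?_).trans
      (Finset.sum_le_univ_sum_of_nonneg fun _ => Nat.zero_le _)
    by_contra hcon
    exact (Finset.mem_filter.1 hj).2 ⟨fun a => L (t j a), by omega, fun x y => hL _ _⟩
  have hcard : N.card + (Finset.univ.filter fun j => G ∉ E j).card = g := by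
    have := Finset.card_filter_add_card_filter_not (s := (Finset.univ : Finset (Fin g)))
      (fun j => G ∈ E j)
    rw [Finset.card_univ, Fintype.card_fin] at this
    convert this
  have h1 : 2 * (Finset.univ.filter fun j => G ∉ E j).card < g := by
    have : 2 * (Finset.univ.filter fun j => G ∉ E j).card * (B + 1) < g * (B + 1) := by
      rw [mul_assoc]
      omega
    exact lt_of_mul_lt_mul_right this (Nat.zero_le _)
  have h2 : (g : ℝ) ≤ 2 * N.card := by
    exact_mod_cast (by omega : g ≤ 2 * N.card)
  linarith

/-! ### Typical weights -/

/-- The properties of the weights on which the lower bound rests: the volume exceeds `n` by a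
constant factor, the sum of the squares is not much larger than `n`, the heaviest vertices contribute
little to it, and there are many vertices, the terminals, whose weight is about
`(log n) ^ (a + 10)`. -/
structure TypicalWeights (a k : ℕ) (δ : ℝ) {n : ℕ} (p : Fin n → ℝ) : Prop where
  pos : ∀ v, 0 < p v
  volume : (1 + δ) * n ≤ weightVolume p
  sq : ∑ v, p v ^ 2 ≤ Real.log n * n
  heavy : ∑ v with Real.log n ^ a < p v, p v ^ 2 ≤ n / Real.log n ^ 3
  terminals : n / Real.log n ^ k ≤
    (Finset.univ.filter fun v => Real.log n ^ (a + 10) ≤ p v ∧ p v ≤ Real.log n ^ (a + 11)).card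

lemma chungLuMeasure_eq_edgeMeasure {n : ℕ} (p : Fin n → ℝ) :
    chungLuMeasure p = edgeMeasure (chungLuEdgeProb p) := rfl

/-- The largest number `l` of steps for which `m ^ l ≤ R`. -/
lemma exists_depth {m R lam δ : ℝ} (hδ : 0 < δ) (hm : 1 + δ ≤ m) (hmlam : m ≤ lam) (hR : 1 ≤ R)
    (hRlog : Real.log R ≤ lam) (hlam : 1 ≤ lam * Real.log (1 + δ)) :
    ∃ l : ℕ, m ^ l ≤ R ∧ R / lam ≤ m ^ l ∧ (l : ℝ) ≤ lam ^ 2 := by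
  obtain ⟨l, h1, h2⟩ := exists_nat_pow_near hR (show 1 < m by linarith)
  have hlam0 : 0 < lam := by linarith
  refine ⟨l, h1, ?_, ?_⟩
  · rw [div_le_iff₀ hlam0]
    refine h2.le.trans ?_
    rw [pow_succ]
    have : 0 ≤ m := by linarith
    gcongr
  · have hlog : 0 < Real.log (1 + δ) := Real.log_pos (by linarith)
    have h3 : l * Real.log (1 + δ) ≤ lam := by
      rw [← Real.log_pow]
      refine (Real.log_le_log (by positivity) ?_).trans hRlog
      exact (pow_le_pow_left₀ (by linarith) hm l).trans h1
    have h4 : (l : ℝ) * Real.log (1 + δ) ≤ lam ^ 2 * Real.log (1 + δ) := by nlinarith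
    exact le_of_mul_le_mul_right h4 hlog

lemma sum_range_pow_le {m : ℝ} (hm : 1 ≤ m) (j : ℕ) :
    ∑ i ∈ Finset.range (j + 1), m ^ i ≤ (j + 1) * m ^ j := by
  calc ∑ i ∈ Finset.range (j + 1), m ^ i ≤ ∑ _i ∈ Finset.range (j + 1), m ^ j :=
        Finset.sum_le_sum fun i hi => pow_le_pow_right₀ hm (by
          have := Finset.mem_range.1 hi
          omega)
    _ = (j + 1) * m ^ j := by
        rw [Finset.sum_const, Finset.card_range, nsmul_eq_mul]
        push_cast
        rfl

/-- The number of short labelings of `2 * s` terminals is negligible against the probability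
`exp (-s ^ 2 / (8 * lam ^ 9))` that a given one is correct. -/
lemma label_count_mul_exp_le {a s B l : ℕ} {n lam R m W ε : ℝ} (hlam24 : 24 ≤ lam) (hn : 0 < n)
    (hnW : n ≤ W)
    (hWlam : W ≤ lam * n) (hR : R = √n / lam ^ (a + 13)) (hs : 3 * lam ^ 10 ≤ s)
    (hB : B ≤ (s : ℝ) ^ 2 / lam ^ 10) (hl2 : R / lam ≤ m ^ l)
    (hl3 : l ≤ lam ^ 2) (hε : ε = (lam ^ 3)⁻¹) :
    2 ^ (2 * s) * 4 ^ B * Real.exp (-((s : ℝ) ^ 2 / 2 *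
      (lam ^ (a + 10) * ((1 - 4 * ε) * m) ^ l) ^ 2 / W)) ≤ 1 / lam := by
  have hlam0 : 0 < lam := by linarith
  have hW0 : 0 < W := hn.trans_le hnW
  have hsqrt : √n ^ 2 = n := Real.sq_sqrt hn.le
  have hε0 : 0 < ε := hε ▸ by positivity
  have hε4 : 4 * ε ≤ 1 := by
    rw [hε, ← div_eq_mul_inv, div_le_one (by positivity)]
    have := le_self_pow₀ (show 1 ≤ lam by linarith) (show 3 ≠ 0 by norm_num)
    linarith
  have hR0 : 0 ≤ R := hR ▸ by positivity
  -- The loss of a factor `1 - 4 * ε` in each of at most `lam ^ 2` steps is bounded in total.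
  have hbern : 1 / 2 ≤ (1 - 4 * ε) ^ l := by
    have h1 := one_add_mul_le_pow (a := -(4 * ε)) (by linarith) l
    rw [← sub_eq_add_neg] at h1
    refine le_trans ?_ h1
    have h2 : l * (4 * ε) ≤ 1 / 2 := by
      calc l * (4 * ε) ≤ lam ^ 2 * (4 * ε) := by gcongr
        _ = 4 / lam := by rw [hε]; field_simp
        _ ≤ 4 / 24 := by gcongr
        _ ≤ 1 / 2 := by norm_num
    linarith
  have hZ : √n / (2 * lam ^ 4) ≤ lam ^ (a + 10) * ((1 - 4 * ε) * m) ^ l := by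
    rw [mul_pow]
    calc √n / (2 * lam ^ 4) = lam ^ (a + 10) * (1 / 2 * (R / lam)) := by
          rw [hR]
          field_simp
          ring
      _ ≤ _ := by
          have : 0 ≤ R / lam := by positivity
          gcongr
  have hZ2 : 1 / (4 * lam ^ 9) ≤ (lam ^ (a + 10) * ((1 - 4 * ε) * m) ^ l) ^ 2 / W := by
    calc 1 / (4 * lam ^ 9) = (√n / (2 * lam ^ 4)) ^ 2 / (lam * n) := by
          rw [div_pow, hsqrt]
          field_simp
          norm_num
      _ ≤ _ := by gcongr
  have hexp : (2 : ℝ) ^ (2 * s) * 4 ^ B ≤ Real.exp (2 * s + 2 * B) := by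
    have h4 : (4 : ℝ) ≤ Real.exp 2 := by
      have := Real.add_one_le_exp (1 : ℝ)
      have h5 : Real.exp 2 = Real.exp 1 * Real.exp 1 := by rw [← Real.exp_add]; norm_num
      rw [h5]
      nlinarith
    calc (2 : ℝ) ^ (2 * s) * 4 ^ B = 4 ^ (s + B) := by
          rw [pow_mul, pow_add]
          norm_num
      _ ≤ Real.exp 2 ^ (s + B) := by gcongr
      _ = Real.exp (2 * s + 2 * B) := by
          rw [← Real.exp_nat_mul]
          congr 1
          push_cast
          ring
  have hexp2 : 2 * (s : ℝ) + 2 * B + -((s : ℝ) ^ 2 / 2 *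
      (lam ^ (a + 10) * ((1 - 4 * ε) * m) ^ l) ^ 2 / W) ≤ -lam := by
    have h1 : (s : ℝ) ^ 2 / 2 * (1 / (4 * lam ^ 9)) ≤ (s : ℝ) ^ 2 / 2 *
        (lam ^ (a + 10) * ((1 - 4 * ε) * m) ^ l) ^ 2 / W := by
      rw [mul_div_assoc]
      gcongr
    have h2 : (s : ℝ) ^ 2 / 2 * (1 / (4 * lam ^ 9)) = lam / 8 * ((s : ℝ) ^ 2 / lam ^ 10) := by
      field_simp
      ring
    have h3 : 3 * (s : ℝ) ≤ (s : ℝ) ^ 2 / lam ^ 10 := by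
      rw [le_div_iff₀ (by positivity)]
      nlinarith
    have h4 : lam ≤ s := by
      have : lam ≤ lam ^ 10 := le_self_pow₀ (by linarith) (by norm_num)
      linarith
    nlinarith
  calc _ ≤ Real.exp (2 * s + 2 * B) * Real.exp (-((s : ℝ) ^ 2 / 2 *
          (lam ^ (a + 10) * ((1 - 4 * ε) * m) ^ l) ^ 2 / W)) := by gcongr
    _ ≤ Real.exp (-lam) := by
        rw [← Real.exp_add]
        exact Real.exp_le_exp.2 hexp2
    _ ≤ 1 / lam := by
        rw [Real.exp_neg, ← one_div]
        refine one_div_le_one_div_of_le hlam0 ?_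
        linarith [Real.add_one_le_exp lam]

/-- The four error terms of `edgeMeasure_short_labels_le` for the chosen parameters: groups of `2 * s`
terminals and depth `l` with `s` and `m ^ l` both about `R = √n / lam ^ (a + 13)`. -/
lemma error_terms_le {a s B l : ℕ} {n lam R m W ε : ℝ} (hlam24 : 24 ≤ lam) (hn : 0 < n)
    (hnW : n ≤ W)
    (hWlam : W ≤ lam * n) (hR : R = √n / lam ^ (a + 13)) (hsR : s ≤ R) (hs : 3 * lam ^ 10 ≤ s)
    (hB : B ≤ (s : ℝ) ^ 2 / lam ^ 10) (hm1 : 1 ≤ m) (hl1 : m ^ l ≤ R) (hl2 : R / lam ≤ m ^ l)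
    (hl3 : l ≤ lam ^ 2) (hε : ε = (lam ^ 3)⁻¹) :
    2 * s * lam ^ (a + 11) * (∑ i ∈ Finset.range (l + 1), m ^ i) / (n / lam ^ (a + 3)) +
      4 * ((lam ^ (a + 11)) ^ 2 / W * ∑ i ∈ Finset.range (2 * l + 1), m ^ i) +
      16 * (l * (lam ^ a / (ε ^ 2 * lam ^ (a + 10)))) +
      2 ^ (2 * s) * 4 ^ B * Real.exp (-((s : ℝ) ^ 2 / 2 *
        (lam ^ (a + 10) * ((1 - 4 * ε) * m) ^ l) ^ 2 / W)) ≤ 33 / lam := by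
  have hlam0 : 0 < lam := by linarith
  have hW0 : 0 < W := hn.trans_le hnW
  have hsqrt : √n ^ 2 = n := Real.sq_sqrt hn.le
  have hR0 : 0 ≤ R := hR ▸ by positivity
  have hR2 : R ^ 2 = n / lam ^ (2 * a + 26) := by
    rw [hR, div_pow, hsqrt, ← pow_mul]
    congr 2
    ring
  have hl1' : (l : ℝ) + 1 ≤ 2 * lam ^ 2 := by nlinarith
  have hl2' : ((2 * l : ℕ) : ℝ) + 1 ≤ 3 * lam ^ 2 := by push_cast; nlinarith
  have hT1 : 2 * s * lam ^ (a + 11) * (∑ i ∈ Finset.range (l + 1), m ^ i) / (n / lam ^ (a + 3)) ≤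
      4 / lam := by
    calc _ ≤ 2 * R * lam ^ (a + 11) * (2 * lam ^ 2 * R) / (n / lam ^ (a + 3)) := by
          gcongr
          exact (sum_range_pow_le hm1 l).trans (by gcongr)
      _ = 4 * lam ^ (a + 13) * lam ^ (a + 3) * R ^ 2 / n := by
          field_simp
          ring
      _ = 4 / lam ^ 10 := by
          rw [hR2]
          field_simp
          ring
      _ ≤ 4 / lam := by
          gcongr
          exact le_self_pow₀ (by linarith) (by norm_num)
  have hT2 : 4 * ((lam ^ (a + 11)) ^ 2 / W * ∑ i ∈ Finset.range (2 * l + 1), m ^ i) ≤ 12 / lam := by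
    calc _ ≤ 4 * ((lam ^ (a + 11)) ^ 2 / n * (3 * lam ^ 2 * R ^ 2)) := by
          gcongr
          refine (sum_range_pow_le hm1 (2 * l)).trans ?_
          rw [mul_comm 2 l, pow_mul, mul_comm l 2]
          gcongr
      _ = 12 / lam ^ 2 := by
          rw [hR2]
          field_simp
          ring
      _ ≤ 12 / lam := by
          gcongr
          exact le_self_pow₀ (by linarith) (by norm_num)
  have hT3 : 16 * (l * (lam ^ a / (ε ^ 2 * lam ^ (a + 10)))) ≤ 16 / lam := by
    calc _ ≤ 16 * (lam ^ 2 * (lam ^ a / (ε ^ 2 * lam ^ (a + 10)))) := by gcongr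
      _ = 16 / lam ^ 2 := by
          rw [hε]
          field_simp
          ring
      _ ≤ 16 / lam := by
          gcongr
          exact le_self_pow₀ (by linarith) (by norm_num)
  have hT4 := label_count_mul_exp_le hlam24 hn hnW hWlam hR hs hB hl2 hl3 hε
  have hsum : (33 : ℝ) / lam = 4 / lam + 12 / lam + 16 / lam + 1 / lam := by ring
  rw [hsum]
  exact add_le_add (add_le_add (add_le_add hT1 hT2) hT3) hT4

/-- For typical weights, the distances within a group of `2 * s` terminals, where `s` is about
`√n / (log n) ^ (a + 13)`, are unlikely to be recovered from labels of total length at most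
`s ^ 2 / (log n) ^ 10`. -/
lemma chungLuMeasure_short_labels_le {a k n : ℕ} {δ lam R : ℝ} {p : Fin n → ℝ} (hδ : 0 < δ)
    (hlam : lam = Real.log n) (hp : TypicalWeights a k δ p) (hlam24 : 24 ≤ lam)
    (hlamδ : 4 * (1 + δ) ≤ δ * lam ^ 3) (hlam2 : lam ^ (2 * a + 22) ≤ n)
    (hlamlog : 1 ≤ lam * Real.log (1 + δ)) (hR : R = √n / lam ^ (a + 13)) {s : ℕ}
    (hR1 : 1 ≤ R) (hsR : (s : ℝ) ≤ R) (hs : 3 * lam ^ 10 ≤ s) {B : ℕ}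
    (hB : (B : ℝ) ≤ (s : ℝ) ^ 2 / lam ^ 10)
    {t : Fin s × Bool → Fin n} (ht : Function.Injective t)
    (htT : ∀ x, t x ∈ Finset.univ.filter fun v =>
      Real.log n ^ (a + 10) ≤ p v ∧ p v ≤ Real.log n ^ (a + 11))
    (D : List Bool → List Bool → ℕ∞) :
    (edgeMeasure (chungLuEdgeProb p)).real {G | ∃ L : Fin s × Bool → List Bool, totalLength L ≤ B ∧
        ∀ x y, D (L x) (L y) = G.edist (t x) (t y)} ≤ 33 / lam := by
  have hlam0 : 0 < lam := by linarith
  have hn : 0 < (n : ℝ) := (by positivity : 0 < lam ^ (2 * a + 22)).trans_le hlam2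
  have hsqrt : √(n : ℝ) ^ 2 = n := Real.sq_sqrt hn.le
  set W := weightVolume p with hW
  set m := (∑ v, p v ^ 2) / W with hm
  set ε := (lam ^ 3)⁻¹ with hε
  have hε0 : 0 < ε := by positivity
  have hnW : (n : ℝ) ≤ W := le_trans (by nlinarith) hp.volume
  have hW0 : 0 < W := hn.trans_le hnW
  have hcs : W ^ 2 ≤ n * ∑ v, p v ^ 2 := by
    have := sq_sum_le_card_mul_sum_sq (s := (Finset.univ : Finset (Fin n))) (f := p)
    rwa [Finset.card_univ, Fintype.card_fin] at this
  have hmW : m * W = ∑ v, p v ^ 2 := div_mul_cancel₀ _ hW0.ne'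
  -- The growth rate is at least the mean weight, by the Cauchy-Schwarz inequality.
  have hm1 : 1 + δ ≤ m := by
    have h1 : (1 + δ) * n * W ≤ n * (m * W) := by
      rw [hmW]
      refine le_trans ?_ hcs
      rw [sq]
      exact mul_le_mul_of_nonneg_right hp.volume hW0.le
    have h2 : (1 + δ) * (n * W) ≤ m * (n * W) := by linarith
    exact le_of_mul_le_mul_right h2 (by positivity)
  have hsqlam : ∑ v, p v ^ 2 ≤ lam * n := hlam ▸ hp.sq
  have hmlam : m ≤ lam := by
    rw [hm, div_le_iff₀ hW0]
    exact hsqlam.trans (mul_le_mul_of_nonneg_left hnW hlam0.le)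
  have hWlam : W ≤ lam * n := by
    refine abs_le_of_sq_le_sq' ?_ (by positivity) |>.2
    have : n * ∑ v, p v ^ 2 ≤ n * (lam * n) := mul_le_mul_of_nonneg_left hsqlam hn.le
    have h3 : (n : ℝ) * (lam * n) ≤ (lam * n) ^ 2 := by
      have : (1 : ℝ) * (lam * n * n) ≤ lam * (lam * n * n) :=
        mul_le_mul_of_nonneg_right (by linarith) (by positivity)
      linarith
    linarith
  have hRlog : Real.log R ≤ lam := by
    rw [hlam]
    refine Real.log_le_log (by linarith) ?_
    have h1 : R ≤ √n := by
      rw [hR]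
      exact div_le_self (Real.sqrt_nonneg _) (one_le_pow₀ (by linarith))
    have h2 : (1 : ℝ) ≤ √n := hR1.trans h1
    nlinarith
  obtain ⟨l, hl1, hl2, hl3⟩ := exists_depth hδ hm1 hmlam hR1 hRlog hlamlog
  have hlam3 : 1 ≤ lam ^ 3 := one_le_pow₀ (by linarith)
  have hε4 : 4 * ε ≤ δ / (1 + δ) := by
    rw [hε, ← div_eq_mul_inv, div_le_div_iff₀ (by positivity) (by positivity)]
    exact hlamδ
  have hρ : 1 ≤ (1 - 4 * ε) * m := by
    have h1 : 1 / (1 + δ) ≤ 1 - 4 * ε := by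
      have : 1 / (1 + δ) = 1 - δ / (1 + δ) := by field_simp; ring
      linarith
    calc (1 : ℝ) = 1 / (1 + δ) * (1 + δ) := by field_simp
      _ ≤ (1 - 4 * ε) * m := mul_le_mul h1 hm1 (by positivity) (le_trans (by positivity) h1)
  have hε1 : 4 * ε ≤ 1 := hε4.trans (by rw [div_le_one (by positivity)]; linarith)
  have hs0 : 0 < s := by
    have : (0 : ℝ) < s := (by positivity : 0 < 3 * lam ^ 10).trans_le hs
    exact_mod_cast this
  have : Nonempty (Fin s) := ⟨⟨0, hs0⟩⟩
  set light := Finset.univ.filter fun v => p v ≤ lam ^ a with hlight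
  have hsq : (1 - ε) * m * W ≤ ∑ v ∈ light, p v ^ 2 := by
    have h1 := Finset.sum_filter_add_sum_filter_not Finset.univ (fun v => p v ≤ lam ^ a)
      fun v => p v ^ 2
    simp only [not_le] at h1
    have h2 := hp.heavy
    rw [← hlam] at h2
    have h3 : n / lam ^ 3 ≤ ε * (m * W) := by
      rw [hε, div_eq_inv_mul, hmW]
      refine mul_le_mul_of_nonneg_left ?_ (by positivity)
      have h4 : (n : ℝ) * n ≤ n * ∑ v, p v ^ 2 := le_trans (by nlinarith) hcs
      exact le_of_mul_le_mul_left h4 hn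
    rw [mul_assoc, sub_mul, one_mul]
    rw [← hlight] at h1
    linarith
  have hmain := edgeMeasure_short_labels_le (chungLuEdgeProb p) ht (light := light)
    (K := lam ^ a) (K₁ := lam ^ (a + 10)) (K₂ := lam ^ (a + 11)) (Y := n / lam ^ (a + 3)) (ε := ε)
    (W := W) hp.pos hW0
    (fun u v => by
      rw [chungLuEdgeProb_mk fun x => (hp.pos x).le]
      exact min_le_left _ _)
    (fun u v hu hv => by
      rw [chungLuEdgeProb_mk fun x => (hp.pos x).le]
      refine min_eq_left ?_
      rw [div_le_one hW0]
      refine (mul_le_mul hu hv (hp.pos v).le (by positivity)).trans (le_trans ?_ hnW)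
      rw [← pow_add]
      refine le_trans (le_of_eq ?_) hlam2
      congr 1
      ring) hm
    (fun v hv => (Finset.mem_filter.1 hv).2) (pow_le_pow_right₀ (by linarith) (by omega))
    (by positivity) (by positivity) hsq (by positivity)
    (by
      rw [pow_add, hε]
      calc lam ^ a * (n / (lam ^ a * lam ^ 3)) = (lam ^ 3)⁻¹ * n := by field_simp
        _ ≤ _ := mul_le_mul_of_nonneg_left hnW (by positivity))
    hε0 hε1 hρ (fun x => hlam ▸ (Finset.mem_filter.1 (htT x)).2.1)
    (fun x => hlam ▸ (Finset.mem_filter.1 (htT x)).2.2) l B D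
  refine hmain.trans ?_
  rw [Fintype.card_fin]
  exact error_terms_le hlam24 hn hnW hWlam hR hsR hs hB (by linarith) hl1 hl2 hl3 hε

/-- For typical weights, the distances are unlikely to be recovered from labels of total length
less than `n ^ (3 / 2) / (log n) ^ (a + k + 24)`. -/
lemma chungLuMeasure_totalLength_lt_le {a k n : ℕ} {δ lam : ℝ} {p : Fin n → ℝ} (hδ : 0 < δ)
    (hlam : lam = Real.log n) (hp : TypicalWeights a k δ p) (hlam24 : 24 ≤ lam)
    (hlamδ : 4 * (1 + δ) ≤ δ * lam ^ 3) (hlam2 : lam ^ (2 * a + 22) ≤ n)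
    (hlamlog : 1 ≤ lam * Real.log (1 + δ)) (hn1 : 6 * lam ^ 10 * lam ^ (a + 13) ≤ √n)
    (hn2 : 2 * √n * lam ^ k ≤ n) (D : List Bool → List Bool → ℕ∞) :
    (chungLuMeasure p).real {G | ∃ L : Fin n → List Bool, RecoversDistances D G L ∧
      totalLength L < (n : ℝ) ^ (3 / 2 : ℝ) / lam ^ (a + k + 24)} ≤ 66 / lam := by
  have hlam0 : 0 < lam := by linarith
  have hn : 0 < (n : ℝ) := (by positivity : 0 < lam ^ (2 * a + 22)).trans_le hlam2
  have hsqrt : √(n : ℝ) * √n = n := Real.mul_self_sqrt hn.le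
  have hsqrt0 : 0 < √(n : ℝ) := Real.sqrt_pos.2 hn
  set R := √n / lam ^ (a + 13) with hR
  have hR6 : 6 * lam ^ 10 ≤ R := by
    rw [hR, le_div_iff₀ (by positivity)]
    exact hn1
  have hlam10 : 1 ≤ lam ^ 10 := one_le_pow₀ (by linarith)
  set s := ⌊R⌋₊ with hs
  have hsR : (s : ℝ) ≤ R := Nat.floor_le (by linarith)
  have hsR2 : R / 2 ≤ s := by
    have := Nat.lt_floor_add_one R
    linarith
  have hs3 : 3 * lam ^ 10 ≤ s := by linarith
  have hs0 : (0 : ℝ) < s := by linarith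
  set B := ⌊(s : ℝ) ^ 2 / lam ^ 10⌋₊ with hB
  set T := Finset.univ.filter fun v =>
    Real.log n ^ (a + 10) ≤ p v ∧ p v ≤ Real.log n ^ (a + 11) with hT
  set g := T.card / (2 * s) with hg
  have hTn : n / lam ^ k ≤ T.card := hlam ▸ hp.terminals
  have hT2 : 2 * (s : ℝ) ≤ T.card := by
    refine le_trans ?_ hTn
    rw [le_div_iff₀ (by positivity)]
    refine le_trans ?_ hn2
    have : R ≤ √n := div_le_self hsqrt0.le (one_le_pow₀ (by linarith))
    gcongr
    linarith
  have hs0' : 0 < s := by exact_mod_cast hs0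
  have hg0 : 0 < g := Nat.div_pos (by exact_mod_cast hT2) (by omega)
  have hgT : (T.card : ℝ) ≤ g * (4 * s) := by
    have h1 : T.card < 2 * s * (g + 1) := Nat.lt_mul_div_succ T.card (by omega)
    have h2 : T.card ≤ g * (4 * s) := by nlinarith
    exact_mod_cast h2
  rw [chungLuMeasure_eq_edgeMeasure]
  have hmain := edgeMeasure_totalLength_lt_le (chungLuEdgeProb p) (T := T) (s := s) (B := B) hg0
    (Nat.div_mul_le_self _ _) (η := 33 / lam) D fun t ht htT =>
      chungLuMeasure_short_labels_le hδ hlam hp hlam24 hlamδ hlam2 hlamlog hR (by linarith) hsR hs3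
        (Nat.floor_le (by positivity)) ht htT D
  refine (measureReal_mono ?_).trans (hmain.trans (le_of_eq (by ring)))
  rintro G ⟨L, hL, hlt⟩
  refine ⟨L, hL, ?_⟩
  have hB1 : (s : ℝ) ^ 2 / lam ^ 10 ≤ B + 1 := (Nat.lt_floor_add_one _).le
  have h32 : (n : ℝ) ^ (3 / 2 : ℝ) = n * √n := by
    rw [Real.sqrt_eq_rpow, ← Real.rpow_one_add' hn.le (by norm_num)]
    norm_num
  have hkey : 2 * ((n : ℝ) ^ (3 / 2 : ℝ) / lam ^ (a + k + 24)) ≤ g * (B + 1) := by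
    calc 2 * ((n : ℝ) ^ (3 / 2 : ℝ) / lam ^ (a + k + 24)) =
          2 / lam * (n / lam ^ k * (R / lam ^ 10)) := by
          rw [h32, hR]
          field_simp
          ring
      _ ≤ 1 / 8 * (n / lam ^ k * (R / lam ^ 10)) := by
          refine mul_le_mul_of_nonneg_right ?_ (by positivity)
          rw [div_le_iff₀ hlam0]
          linarith
      _ ≤ 1 / 8 * (g * (4 * s) * (2 * s / lam ^ 10)) := by
          have : n / lam ^ k ≤ g * (4 * s) := hTn.trans hgT
          have h2 : R ≤ 2 * s := by linarith
          gcongr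
      _ = g * (s ^ 2 / lam ^ 10) := by ring
      _ ≤ g * (B + 1) := by gcongr
  have : (2 * totalLength L : ℝ) < g * (B + 1) := by linarith
  exact_mod_cast this

/-! ### Sums of independent power-law weights -/

section IIDSums

variable {μ : Measure ℝ} [IsProbabilityMeasure μ]

lemma integrable_comp_eval {n : ℕ} {f : ℝ → ℝ} (hf : Integrable f μ) (v : Fin n) :
    Integrable (fun p : Fin n → ℝ => f (p v)) (Measure.pi fun _ => μ) :=
  (measurePreserving_eval (fun _ : Fin n => μ) v).integrable_comp_of_integrable hf

lemma integral_comp_eval {n : ℕ} {f : ℝ → ℝ} (hf : Integrable f μ) (v : Fin n) :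
    ∫ p : Fin n → ℝ, f (p v) ∂(Measure.pi fun _ => μ) = ∫ x, f x ∂μ := by
  have hmp := measurePreserving_eval (fun _ : Fin n => μ) v
  have h := integral_map (μ := Measure.pi fun _ : Fin n => μ) (φ := Function.eval v) (f := f)
    hmp.measurable.aemeasurable (by rw [hmp.map_eq]; exact hf.aestronglyMeasurable)
  rw [hmp.map_eq] at h
  exact h.symm

lemma measureReal_pi_sum_ge_le {n : ℕ} {f : ℝ → ℝ} (hf : Integrable f μ) (hf0 : 0 ≤ᵐ[μ] f) {Y : ℝ}
    (hY : 0 < Y) :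
    (Measure.pi fun _ : Fin n => μ).real {p | Y ≤ ∑ v, f (p v)} ≤ n * (∫ x, f x ∂μ) / Y := by
  have hnn : 0 ≤ᵐ[Measure.pi fun _ : Fin n => μ] fun p => ∑ v, f (p v) := by
    have : ∀ v, ∀ᵐ p ∂(Measure.pi fun _ : Fin n => μ), 0 ≤ f (p v) := fun v =>
      (measurePreserving_eval (fun _ : Fin n => μ) v).quasiMeasurePreserving.ae hf0
    filter_upwards [ae_all_iff.2 this] with p hp
    exact Finset.sum_nonneg fun v _ => hp v
  have h := mul_meas_ge_le_integral_of_nonneg hnn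
    (integrable_finsetSum _ fun v _ => integrable_comp_eval hf v) Y
  rw [integral_finsetSum _ fun v _ => integrable_comp_eval hf v,
    Finset.sum_congr rfl fun v _ => integral_comp_eval hf v, Finset.sum_const, Finset.card_univ,
    Fintype.card_fin, nsmul_eq_mul] at h
  rw [le_div_iff₀ hY, mul_comm]
  exact h

lemma measureReal_pi_sum_le_le {n : ℕ} (hn : 0 < n) {f : ℝ → ℝ} (hf : MemLp f 2 μ) {r : ℝ}
    (hr : 0 < r) :
    (Measure.pi fun _ : Fin n => μ).real {p | ∑ v, f (p v) ≤ n * (∫ x, f x ∂μ - r)} ≤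
      Var[f; μ] / (n * r ^ 2) := by
  set P := Measure.pi fun _ : Fin n => μ with hP
  have hn' : (0 : ℝ) < n := by exact_mod_cast hn
  have hint : Integrable f μ := hf.integrable (by norm_num)
  set S : (Fin n → ℝ) → ℝ := ∑ v, fun p => f (p v) with hS
  have hvar : Var[S; P] = n * Var[f; μ] := by
    rw [hS, variance_sum_pi fun _ => hf, Finset.sum_const, Finset.card_univ, Fintype.card_fin,
      nsmul_eq_mul]
  have hmean : P[S] = n * ∫ x, f x ∂μ := by
    simp only [hS, Finset.sum_apply]
    rw [integral_finsetSum _ fun v _ => integrable_comp_eval hint v,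
      Finset.sum_congr rfl fun v _ => integral_comp_eval hint v, Finset.sum_const, Finset.card_univ,
      Fintype.card_fin, nsmul_eq_mul]
  have hmem : MemLp S 2 P := memLp_finsetSum' _ fun v _ =>
    hf.comp_measurePreserving (measurePreserving_eval (fun _ : Fin n => μ) v)
  have hc := meas_ge_le_variance_div_sq hmem (mul_pos hn' hr)
  have hsub : {p : Fin n → ℝ | ∑ v, f (p v) ≤ n * (∫ x, f x ∂μ - r)} ⊆
      {p | n * r ≤ |S p - P[S]|} := by
    intro p hp
    rw [Set.mem_ofPred_eq] at hp
    rw [Set.mem_ofPred_eq, hmean, hS, Finset.sum_apply, abs_sub_comm]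
    refine le_trans ?_ (le_abs_self _)
    linarith
  refine (measureReal_mono hsub).trans ?_
  rw [Measure.real]
  refine (ENNReal.toReal_mono ENNReal.ofReal_ne_top hc).trans ?_
  rw [ENNReal.toReal_ofReal (div_nonneg (variance_nonneg _ _) (sq_nonneg _)), hvar]
  apply le_of_eq
  field_simp

end IIDSums

section PowerLaw

variable {β xmin : ℝ}

lemma isProbabilityMeasure_powerLaw (hβ : 1 < β) (hx : 0 < xmin) :
    IsProbabilityMeasure (powerLaw β xmin) :=
  isProbabilityMeasure_paretoMeasure hx (sub_pos.2 hβ)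

lemma measurable_powerLaw_density (β xmin : ℝ) : Measurable fun x : ℝ =>
    ENNReal.ofReal (if xmin ≤ x then (β - 1) * xmin ^ (β - 1) * x ^ (-β) else 0) := by
  refine ENNReal.measurable_ofReal.comp (Measurable.ite measurableSet_Ici ?_ measurable_const)
  fun_prop

lemma ae_le_powerLaw (β xmin : ℝ) : ∀ᵐ x ∂(powerLaw β xmin), xmin ≤ x := by
  rw [powerLaw_eq_withDensity, ae_withDensity_iff (measurable_powerLaw_density β xmin)]
  refine Filter.Eventually.of_forall fun x hx => ?_
  by_contra h
  simp [h] at hx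

/-- The moments of order less than `β - 1` are finite. -/
lemma integrable_rpow_powerLaw (hβ : 1 < β) (hx : 0 < xmin) {r : ℝ} (hr : r < β - 1) :
    Integrable (fun x => x ^ r) (powerLaw β xmin) := by
  rw [powerLaw_eq_withDensity, integrable_withDensity_iff (measurable_powerLaw_density β xmin)
    (Filter.Eventually.of_forall fun _ => ENNReal.ofReal_lt_top)]
  have h : IntegrableOn (fun x : ℝ => (β - 1) * xmin ^ (β - 1) * x ^ (r - β)) (Set.Ici xmin) := by
    rw [integrableOn_Ici_iff_integrableOn_Ioi]
    exact (integrableOn_Ioi_rpow_of_lt (by linarith) hx).const_mul _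
  rw [← integrable_indicator_iff measurableSet_Ici] at h
  refine h.congr (Filter.Eventually.of_forall fun x => ?_)
  simp only [Set.indicator_apply, Set.mem_Ici]
  split_ifs with hxx
  · have hx0 : 0 < x := hx.trans_le hxx
    have hc : 0 ≤ (β - 1) * xmin ^ (β - 1) := mul_nonneg (by linarith) (by positivity)
    rw [ENNReal.toReal_ofReal (by positivity), show r - β = r + -β by ring, Real.rpow_add hx0]
    ring
  · simp

/-- The power law gives mass at least of order `A ^ (1 - β)` to the interval `[A, 2 * A]`. -/
lemma le_powerLaw_Icc (hβ : 1 < β) (hx : 0 < xmin) {A B : ℝ} (hA : xmin ≤ A) (hB : 2 * A ≤ B) :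
    (β - 1) * xmin ^ (β - 1) * 2 ^ (-β) * A ^ (1 - β) ≤ (powerLaw β xmin).real (Set.Icc A B) := by
  have := isProbabilityMeasure_powerLaw hβ hx
  have hA0 : 0 < A := hx.trans_le hA
  refine le_trans ?_ (measureReal_mono (Set.Icc_subset_Icc_right hB))
  rw [Measure.real, ← ENNReal.ofReal_le_iff_le_toReal (measure_ne_top _ _),
    powerLaw_eq_withDensity, withDensity_apply _ measurableSet_Icc]
  calc ENNReal.ofReal ((β - 1) * xmin ^ (β - 1) * 2 ^ (-β) * A ^ (1 - β)) =
        ∫⁻ _x in Set.Icc A (2 * A), ENNReal.ofReal ((β - 1) * xmin ^ (β - 1) * (2 * A) ^ (-β)) := by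
        rw [setLIntegral_const, Real.volume_Icc, ← ENNReal.ofReal_mul]
        · congr 1
          rw [Real.mul_rpow (by norm_num) hA0.le, show 1 - β = -β + 1 by ring,
            Real.rpow_add_one hA0.ne']
          ring
        · have : 0 ≤ β - 1 := by linarith
          positivity
    _ ≤ _ := by
        refine setLIntegral_mono (measurable_powerLaw_density β xmin) fun x hxA => ?_
        rw [if_pos (hA.trans hxA.1)]
        refine ENNReal.ofReal_le_ofReal (mul_le_mul_of_nonneg_left ?_
          (mul_nonneg (by linarith) (by positivity)))
        exact Real.rpow_le_rpow_of_nonpos (hA0.trans_le hxA.1) hxA.2 (by linarith)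

end PowerLaw

/-! ### The weights are typical -/

lemma tendsto_log_natCast : Filter.Tendsto (fun n : ℕ => Real.log n) Filter.atTop Filter.atTop :=
  Real.tendsto_log_atTop.comp tendsto_natCast_atTop_atTop

/-- Powers of the logarithm are negligible against positive powers. -/
lemma tendsto_log_pow_div_rpow (j : ℕ) {r : ℝ} (hr : 0 < r) :
    Filter.Tendsto (fun n : ℕ => Real.log n ^ j / (n : ℝ) ^ r) Filter.atTop (nhds 0) := by
  have h := (isLittleO_log_rpow_rpow_atTop (j : ℝ) hr).tendsto_div_nhds_zero
  simp only [Real.rpow_natCast] at h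
  exact h.comp tendsto_natCast_atTop_atTop

/-- The weights are typical with high probability. -/
lemma tendsto_not_typicalWeights {β xmin : ℝ} (hβ : 3 < β) (hxmin : 0 < xmin)
    (hν : 1 < ∫ x, x ∂(powerLaw β xmin)) : ∃ (a k : ℕ) (δ : ℝ), 0 < δ ∧
      Filter.Tendsto (fun n : ℕ => (Measure.pi fun _ : Fin n => powerLaw β xmin).real
        {p | ¬ TypicalWeights a k δ p}) Filter.atTop (nhds 0) := by
  have := isProbabilityMeasure_powerLaw (show 1 < β by linarith) hxmin
  set μ := powerLaw β xmin with hμ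
  set ν := ∫ x, x ∂μ with hν'
  set δ := (ν - 1) / 2 with hδ
  have hδ0 : 0 < δ := by rw [hδ]; linarith
  -- `2 + η` is the order of a finite moment, and `a * η` is large.
  set η := (β - 3) / 2 with hη
  have hη0 : 0 < η := by rw [hη]; linarith
  obtain ⟨a, ha⟩ := exists_nat_ge (5 / η)
  have haη : 5 ≤ a * η := by rwa [div_le_iff₀ hη0] at ha
  obtain ⟨k, hk⟩ := exists_nat_ge ((a + 10 : ℕ) * (β - 1) + 1)
  refine ⟨a, k, δ, hδ0, ?_⟩
  have hae := ae_le_powerLaw β xmin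
  rw [← hμ] at hae
  have hmom2 : Integrable (fun x => x ^ (2 : ℝ)) μ :=
    integrable_rpow_powerLaw (by linarith) hxmin (by linarith)
  have hmomη : Integrable (fun x => x ^ (2 + η)) μ :=
    integrable_rpow_powerLaw (by linarith) hxmin (by rw [hη]; linarith)
  have hmem : MemLp (fun x : ℝ => x) 2 μ := by
    refine (memLp_two_iff_integrable_sq (f := fun x : ℝ => x) measurable_id.aestronglyMeasurable).2 ?_
    simpa only [Real.rpow_two] using hmom2
  simp only [Real.rpow_two] at hmom2
  set C₂ := ∫ x, x ^ 2 ∂μ with hC₂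
  set C₃ := ∫ x, x ^ (2 + η) ∂μ with hC₃
  set Vx := Var[fun x : ℝ => x; μ] with hVx
  set bound : ℕ → ℝ := fun n => Vx / (n * δ ^ 2) + C₂ / Real.log n + C₃ / Real.log n ^ 2 +
    Real.log n ^ (2 * k) / n with hbound
  have hlog := tendsto_log_natCast
  have hb0 : Filter.Tendsto bound Filter.atTop (nhds 0) := by
    have h1 : Filter.Tendsto (fun n : ℕ => Vx / (n * δ ^ 2)) Filter.atTop (nhds 0) :=
      Filter.Tendsto.div_atTop tendsto_const_nhds
        (tendsto_natCast_atTop_atTop.atTop_mul_const (by positivity))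
    have h2 : Filter.Tendsto (fun n : ℕ => C₂ / Real.log n) Filter.atTop (nhds 0) :=
      Filter.Tendsto.div_atTop tendsto_const_nhds hlog
    have h3 : Filter.Tendsto (fun n : ℕ => C₃ / Real.log n ^ 2) Filter.atTop (nhds 0) :=
      Filter.Tendsto.div_atTop tendsto_const_nhds
        ((Filter.tendsto_pow_atTop (by norm_num)).comp hlog)
    have h4 := tendsto_log_pow_div_rpow (2 * k) one_pos
    simp only [Real.rpow_one] at h4
    simpa using ((h1.add h2).add h3).add h4
  have hc0 : 0 < (β - 1) * xmin ^ (β - 1) * 2 ^ (-β) := by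
    have : 0 < β - 1 := by linarith
    positivity
  set c := (β - 1) * xmin ^ (β - 1) * 2 ^ (-β) with hc
  refine tendsto_of_tendsto_of_tendsto_of_le_of_le' tendsto_const_nhds hb0
    (Filter.Eventually.of_forall fun n => measureReal_nonneg) ?_
  filter_upwards [Filter.eventually_gt_atTop 0, hlog.eventually_ge_atTop 2,
    hlog.eventually_ge_atTop xmin, hlog.eventually_ge_atTop (2 / c)] with n hn hn2 hnx hnc
  set lam := Real.log n with hlam
  have hn' : (0 : ℝ) < n := by exact_mod_cast hn
  have hlam0 : 0 < lam := by linarith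
  set P := Measure.pi fun _ : Fin n => μ with hP
  set Iv := Set.Icc (lam ^ (a + 10)) (lam ^ (a + 11)) with hIv
  set f : ℝ → ℝ := Iv.indicator fun _ => 1 with hf
  have hfint : ∫ x, f x ∂μ = μ.real Iv := by
    rw [hf, integral_indicator_const _ measurableSet_Icc, smul_eq_mul, mul_one]
  have hmass : 2 / lam ^ k ≤ μ.real Iv := by
    refine le_trans ?_ (le_powerLaw_Icc (by linarith) hxmin (hnx.trans (le_self_pow₀ (by linarith)
      (by omega))) ?_)
    · rw [← hc, ← Real.rpow_natCast lam (a + 10), ← Real.rpow_mul hlam0.le]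
      have h1 : 2 ≤ c * lam := by rwa [div_le_iff₀' hc0] at hnc
      calc 2 / lam ^ k ≤ c * lam / lam ^ k := by gcongr
        _ = c * lam ^ (1 - k : ℝ) := by
            rw [Real.rpow_sub hlam0, Real.rpow_one, Real.rpow_natCast]
            ring
        _ ≤ _ := by
            refine mul_le_mul_of_nonneg_left (Real.rpow_le_rpow_of_exponent_le (by linarith) ?_)
              hc0.le
            linarith
    · calc 2 * lam ^ (a + 10) ≤ lam * lam ^ (a + 10) :=
            mul_le_mul_of_nonneg_right hn2 (by positivity)
        _ = lam ^ (a + 11) := by ring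
  set r := (lam ^ k)⁻¹ with hr
  have hr0 : 0 < r := by positivity
  set E₁ : Set (Fin n → ℝ) := {p | ∑ v, p v ≤ n * (ν - δ)} with hE₁
  set E₂ : Set (Fin n → ℝ) := {p | n * lam ≤ ∑ v, p v ^ 2} with hE₂
  set E₃ : Set (Fin n → ℝ) := {p | n * lam ^ 2 ≤ ∑ v, p v ^ (2 + η)} with hE₃
  set E₄ : Set (Fin n → ℝ) := {p | ∑ v, f (p v) ≤ n * (∫ x, f x ∂μ - r)} with hE₄
  have hP1 : P.real E₁ ≤ Vx / (n * δ ^ 2) := measureReal_pi_sum_le_le hn hmem hδ0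
  have hP2 : P.real E₂ ≤ C₂ / lam := by
    refine (measureReal_pi_sum_ge_le hmom2 (Filter.Eventually.of_forall fun x => sq_nonneg x)
      (by positivity)).trans (le_of_eq ?_)
    rw [← hC₂]
    field_simp
  have hP3 : P.real E₃ ≤ C₃ / lam ^ 2 := by
    refine (measureReal_pi_sum_ge_le hmomη (hae.mono fun x hx => Real.rpow_nonneg
      (hxmin.le.trans hx) _) (by positivity)).trans (le_of_eq ?_)
    rw [← hC₃]
    field_simp
  have hP4 : P.real E₄ ≤ lam ^ (2 * k) / n := by
    have hfm : MemLp f 2 μ := (memLp_const (1 : ℝ)).indicator measurableSet_Icc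
    refine (measureReal_pi_sum_le_le hn hfm hr0).trans ?_
    have hv : Var[f; μ] ≤ 1 := by
      refine (variance_le_expectation_sq hfm.aestronglyMeasurable).trans ?_
      have : f ^ 2 = f := by
        ext x
        simp only [hf, Pi.pow_apply, Set.indicator_apply]
        split_ifs <;> norm_num
      rw [this, hfint]
      exact measureReal_le_one
    calc Var[f; μ] / (n * r ^ 2) ≤ 1 / (n * r ^ 2) := by gcongr
      _ = lam ^ (2 * k) / n := by
          rw [hr]
          field_simp
          ring
  have haep : ∀ᵐ p ∂P, ∀ v, xmin ≤ p v := ae_all_iff.2 fun v =>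
    (measurePreserving_eval (fun _ : Fin n => μ) v).quasiMeasurePreserving.ae hae
  have hsub : ∀ᵐ p ∂P, p ∈ {p : Fin n → ℝ | ¬ TypicalWeights a k δ p} →
      p ∈ E₁ ∪ E₂ ∪ E₃ ∪ E₄ := by
    filter_upwards [haep] with p hp hnot
    by_contra hE
    simp only [Set.mem_union, not_or] at hE
    obtain ⟨⟨⟨h1, h2⟩, h3⟩, h4⟩ := hE
    simp only [hE₁, hE₂, hE₃, hE₄, Set.mem_ofPred_eq, not_le] at h1 h2 h3 h4
    have hpos : ∀ v, 0 < p v := fun v => hxmin.trans_le (hp v)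
    refine hnot ⟨hpos, ?_, ?_, ?_, ?_⟩
    · rw [weightVolume]
      refine le_trans (le_of_eq ?_) h1.le
      rw [hδ]
      ring
    · rw [mul_comm]
      exact h2.le
    · -- A weight above `lam ^ a` has `p ^ 2 ≤ p ^ (2 + η) / lam ^ 5`.
      have hterm : ∀ v ∈ Finset.univ.filter (fun v => lam ^ a < p v),
          p v ^ 2 ≤ p v ^ (2 + η) / lam ^ 5 := by
        intro v hv
        have hv' := (Finset.mem_filter.1 hv).2
        rw [le_div_iff₀ (by positivity), Real.rpow_add (hpos v), Real.rpow_two]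
        refine mul_le_mul_of_nonneg_left ?_ (sq_nonneg _)
        calc lam ^ 5 = lam ^ (5 : ℝ) := by
              rw [← Real.rpow_natCast]
              norm_num
          _ ≤ lam ^ (a * η) := Real.rpow_le_rpow_of_exponent_le (by linarith) haη
          _ = (lam ^ a) ^ η := by rw [Real.rpow_mul hlam0.le, Real.rpow_natCast]
          _ ≤ p v ^ η := Real.rpow_le_rpow (by positivity) hv'.le hη0.le
      calc ∑ v with lam ^ a < p v, p v ^ 2 ≤ ∑ v with lam ^ a < p v, p v ^ (2 + η) / lam ^ 5 :=
            Finset.sum_le_sum hterm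
        _ ≤ ∑ v, p v ^ (2 + η) / lam ^ 5 := Finset.sum_le_sum_of_subset_of_nonneg
            (Finset.filter_subset _ _) fun v _ _ => by have := hpos v; positivity
        _ = (∑ v, p v ^ (2 + η)) / lam ^ 5 := by rw [Finset.sum_div]
        _ ≤ n * lam ^ 2 / lam ^ 5 := by gcongr
        _ = n / lam ^ 3 := by field_simp
    · have hcount : ∑ v, f (p v) = (Finset.univ.filter fun v =>
          lam ^ (a + 10) ≤ p v ∧ p v ≤ lam ^ (a + 11)).card := by
        rw [Finset.card_filter, Nat.cast_sum]
        refine Finset.sum_congr rfl fun v _ => ?_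
        simp only [hf, hIv, Set.indicator_apply, Set.mem_Icc, Nat.cast_ite, Nat.cast_one,
          Nat.cast_zero]
      rw [← hcount]
      refine le_trans ?_ h4.le
      rw [hfint, div_eq_mul_inv]
      refine mul_le_mul_of_nonneg_left ?_ hn'.le
      rw [div_eq_mul_inv] at hmass
      linarith
  calc P.real {p | ¬ TypicalWeights a k δ p} ≤ P.real (E₁ ∪ E₂ ∪ E₃ ∪ E₄) :=
        ENNReal.toReal_mono (measure_ne_top _ _) (measure_mono_ae hsub)
    _ ≤ P.real E₁ + P.real E₂ + P.real E₃ + P.real E₄ := by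
        refine (measureReal_union_le _ _).trans (add_le_add_left ?_ _)
        refine (measureReal_union_le _ _).trans (add_le_add_left ?_ _)
        exact measureReal_union_le _ _
    _ ≤ bound n := add_le_add (add_le_add (add_le_add hP1 hP2) hP3) hP4

/-! ### Turning a 2-hop cover into a labeling -/

section Encoding

/-- Concatenation of the code words `φ a`, all of length `b`, for the elements `a` of a list. -/
def blockEncode {A : Type*} {b : ℕ} (φ : A → Fin b → Bool) (l : List A) : List Bool :=
  l.flatMap fun a => List.ofFn (φ a)

lemma length_blockEncode {A : Type*} {b : ℕ} (φ : A → Fin b → Bool) (l : List A) :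
    (blockEncode φ l).length = l.length * b := by
  simp [blockEncode, List.length_flatMap]

lemma blockEncode_injective {A : Type*} {b : ℕ} (hb : 0 < b) {φ : A → Fin b → Bool}
    (hφ : Function.Injective φ) : Function.Injective (blockEncode φ) := by
  intro l
  induction l with
  | nil =>
    intro l' h
    have := congrArg List.length h
    rw [length_blockEncode, length_blockEncode] at this
    simp only [List.length_nil, zero_mul] at this
    have h2 := (Nat.mul_eq_zero.1 this.symm).resolve_right hb.ne'
    exact (List.length_eq_zero_iff.1 h2).symm
  | cons a l ih =>
    intro l' h
    cases l' with
    | nil =>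
      have := congrArg List.length h
      rw [length_blockEncode, length_blockEncode] at this
      simp [hb.ne'] at this
    | cons a' l' =>
      simp only [blockEncode, List.flatMap_cons] at h
      obtain ⟨h1, h2⟩ := List.append_inj h (by simp)
      rw [hφ (List.ofFn_injective h1), ih h2]

/-- A distance in a graph on `n` vertices as an element of `Fin (n + 1)`, with `n` for `⊤`. -/
noncomputable def distCode (n : ℕ) (d : ℕ∞) : Fin (n + 1) := Fin.ofNat (n + 1) (min d n).toNat

/-- The distance with a given code. -/
def distDecode (n : ℕ) (i : Fin (n + 1)) : ℕ∞ := if (i : ℕ) = n then ⊤ else (i : ℕ)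

lemma distDecode_distCode {n : ℕ} (G : SimpleGraph (Fin n)) (x y : Fin n) :
    distDecode n (distCode n (G.edist x y)) = G.edist x y := by
  by_cases hr : G.Reachable x y
  · obtain ⟨w, hw, hl⟩ := hr.exists_path_of_dist
    have hlt : G.dist x y < n := by
      have := hw.length_lt
      rwa [Fintype.card_fin, hl] at this
    rw [← hr.coe_dist_eq_edist, distCode, min_eq_left (by exact_mod_cast hlt.le), ENat.toNat_natCast,
      distDecode, Fin.val_ofNat, Nat.mod_eq_of_lt (by omega), if_neg hlt.ne]
  · rw [SimpleGraph.edist_eq_top_of_not_reachable hr, distCode, min_eq_right le_top,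
      ENat.toNat_natCast, distDecode, Fin.val_ofNat, Nat.mod_eq_of_lt (by omega), if_pos rfl]

/-- The minimum of `dist x z + dist z y` over the common landmarks `z` listed in the tables of `x`
and `y`. The entries with the tag `true` are forward landmarks, those with `false` backward ones. -/
noncomputable def tableDist {n : ℕ} (A A' : List (Bool × Fin n × Fin (n + 1))) : ℕ∞ :=
  ⨅ e ∈ A, ⨅ e' ∈ A', if e.1 = true ∧ e'.1 = false ∧ e.2.1 = e'.2.1 then
    distDecode n e.2.2 + distDecode n e'.2.2 else ⊤

/-- The table of the landmarks of `x` together with their distances. -/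
noncomputable def landmarkTable {n : ℕ} (G : SimpleGraph (Fin n))
    (LF LB : Fin n → Finset (Fin n)) (x : Fin n) : List (Bool × Fin n × Fin (n + 1)) :=
  (LF x).toList.map (fun z => (true, z, distCode n (G.edist x z))) ++
    (LB x).toList.map fun z => (false, z, distCode n (G.edist z x))

lemma tableDist_landmarkTable {n : ℕ} (G : SimpleGraph (Fin n)) (LF LB : Fin n → Finset (Fin n))
    (x y : Fin n) : tableDist (landmarkTable G LF LB x) (landmarkTable G LF LB y) =
      ⨅ z ∈ LF x ∩ LB y, (G.edist x z + G.edist z y) := by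
  apply le_antisymm
  · refine le_iInf₂ fun z hz => ?_
    obtain ⟨hF, hB⟩ := Finset.mem_inter.1 hz
    refine (iInf₂_le (true, z, distCode n (G.edist x z)) ?_).trans
      ((iInf₂_le (false, z, distCode n (G.edist z y)) ?_).trans ?_)
    · simp [landmarkTable, hF]
    · simp [landmarkTable, hB]
    · simp [distDecode_distCode]
  · refine le_iInf₂ fun e he => le_iInf₂ fun e' he' => ?_
    split_ifs with h
    · obtain ⟨h1, h2, h3⟩ := h
      obtain ⟨z, hz, rfl⟩ : ∃ z ∈ LF x, (true, z, distCode n (G.edist x z)) = e := by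
        rcases List.mem_append.1 he with he | he
        · obtain ⟨z, hz, rfl⟩ := List.mem_map.1 he
          exact ⟨z, Finset.mem_toList.1 hz, rfl⟩
        · obtain ⟨z, hz, rfl⟩ := List.mem_map.1 he
          simp at h1
      obtain ⟨z', hz', rfl⟩ : ∃ z ∈ LB y, (false, z, distCode n (G.edist z y)) = e' := by
        rcases List.mem_append.1 he' with he | he
        · obtain ⟨z, hz, rfl⟩ := List.mem_map.1 he
          simp at h2
        · obtain ⟨z, hz, rfl⟩ := List.mem_map.1 he
          exact ⟨z, Finset.mem_toList.1 hz, rfl⟩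
      simp only at h3
      subst h3
      rw [distDecode_distCode, distDecode_distCode]
      exact iInf₂_le z (Finset.mem_inter.2 ⟨hz, hz'⟩)
    · exact le_top

/-- The landmarks of a 2-hop cover and their distances can be written down with
`2 * log₂ n + 4` bits for each landmark, and the distances can be recovered from these labels. -/
lemma exists_decoder_of_twoHopCover (n : ℕ) : ∃ D : List Bool → List Bool → ℕ∞,
    ∀ (G : SimpleGraph (Fin n)) (LF LB : Fin n → Finset (Fin n)), IsTwoHopCover G LF LB →
      ∃ L : Fin n → List Bool, RecoversDistances D G L ∧
        totalLength L = totalLandmarks LF LB * (2 * Nat.log 2 n + 4) := by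
  set b := 2 * Nat.log 2 n + 4 with hb
  obtain ⟨φ⟩ : Nonempty (Bool × Fin n × Fin (n + 1) ↪ (Fin b → Bool)) := by
    apply Function.Embedding.nonempty_of_card_le
    simp only [Fintype.card_prod, Fintype.card_bool, Fintype.card_fin, Fintype.card_fun]
    have h : n + 1 ≤ 2 ^ (Nat.log 2 n + 1) := Nat.lt_pow_succ_log_self (by norm_num) n
    have hb' : 2 ^ b = 2 ^ (Nat.log 2 n + 1) * 2 ^ (Nat.log 2 n + 1) * 4 := by
      rw [hb]
      ring
    rw [hb']
    nlinarith
  have hinj := blockEncode_injective (show 0 < b by omega) φ.injective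
  refine ⟨fun w w' => tableDist (Function.invFun (blockEncode φ) w)
    (Function.invFun (blockEncode φ) w'), fun G LF LB h =>
      ⟨fun x => blockEncode φ (landmarkTable G LF LB x), fun x y => ?_, ?_⟩⟩
  · simp only [Function.leftInverse_invFun hinj _]
    rw [tableDist_landmarkTable]
    exact h x y
  · simp [totalLength, totalLandmarks, length_blockEncode, landmarkTable, Finset.sum_mul]

end Encoding

/-! ### Random power-law graphs -/

/-- For every sequence of decoders, the distances in a random power-law graph are unlikely to be
recovered from labels of total length less than `n ^ (3 / 2) / (log n) ^ k`. -/
lemma exists_tendsto_totalLength_lt {β xmin : ℝ} (hβ : 3 < β) (hxmin : 0 < xmin)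
    (hν : 1 < ∫ x, x ∂(powerLaw β xmin)) : ∃ k : ℕ, ∀ D : ℕ → List Bool → List Bool → ℕ∞,
      Filter.Tendsto (fun n : ℕ => powerLawGraph β xmin n {G | ∃ L : Fin n → List Bool,
        RecoversDistances (D n) G L ∧ totalLength L < (n : ℝ) ^ (3 / 2 : ℝ) / Real.log n ^ k})
        Filter.atTop (nhds 0) := by
  have := isProbabilityMeasure_powerLaw (show 1 < β by linarith) hxmin
  obtain ⟨a, k, δ, hδ, hlim⟩ := tendsto_not_typicalWeights hβ hxmin hν
  refine ⟨a + k + 24, fun D => ?_⟩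
  have hlog := tendsto_log_natCast
  have hsqrt : ∀ (j : ℕ) (c : ℝ), 0 < c → ∀ᶠ n : ℕ in Filter.atTop, Real.log n ^ j ≤ c * √n := by
    intro j c hc
    filter_upwards [(tendsto_log_pow_div_rpow j (show (0 : ℝ) < 1 / 2 by norm_num)).eventually_lt_const
      hc, Filter.eventually_gt_atTop 0] with n hn hn0
    have hn' : (0 : ℝ) < n := by exact_mod_cast hn0
    rw [← Real.sqrt_eq_rpow, div_lt_iff₀ (Real.sqrt_pos.2 hn')] at hn
    exact hn.le
  have h66 : Filter.Tendsto (fun n : ℕ => (Measure.pi fun _ : Fin n => powerLaw β xmin).real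
      {p | ¬ TypicalWeights a k δ p} + 66 / Real.log n) Filter.atTop (nhds 0) := by
    simpa using hlim.add (Filter.Tendsto.div_atTop tendsto_const_nhds hlog)
  have h66' := ENNReal.tendsto_ofReal h66
  rw [ENNReal.ofReal_zero] at h66'
  refine tendsto_of_tendsto_of_tendsto_of_le_of_le' tendsto_const_nhds h66'
    (Filter.Eventually.of_forall fun _ => zero_le) ?_
  filter_upwards [hlog.eventually_ge_atTop 24, hlog.eventually_ge_atTop (4 * (1 + δ) / δ),
    hlog.eventually_ge_atTop (1 / Real.log (1 + δ)), hsqrt (2 * a + 22) 1 one_pos,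
    hsqrt (a + 23) (1 / 6) (by norm_num), hsqrt k (1 / 2) (by norm_num),
    Filter.eventually_gt_atTop 0] with n h1 h2 h3 h4 h5 h6 hn0
  have hn : (1 : ℝ) ≤ n := by exact_mod_cast hn0
  have hss : √(n : ℝ) * √n = n := Real.mul_self_sqrt (by linarith)
  have hs1 : 1 ≤ √(n : ℝ) := Real.one_le_sqrt.2 hn
  set lam := Real.log n with hlam
  have hδlam : 4 * (1 + δ) ≤ δ * lam ^ 3 := by
    rw [div_le_iff₀ hδ] at h2
    have : lam ≤ lam ^ 3 := le_self_pow₀ (by linarith) (by norm_num)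
    nlinarith
  have hlamlog : 1 ≤ lam * Real.log (1 + δ) := by
    rwa [div_le_iff₀ (Real.log_pos (by linarith))] at h3
  have hlam2 : lam ^ (2 * a + 22) ≤ n := by nlinarith
  have hn1 : 6 * lam ^ 10 * lam ^ (a + 13) ≤ √n := by
    have : 6 * lam ^ 10 * lam ^ (a + 13) = 6 * lam ^ (a + 23) := by ring
    linarith
  have hn2 : 2 * √n * lam ^ k ≤ n := by nlinarith
  set E : Set (SimpleGraph (Fin n)) := {G | ∃ L : Fin n → List Bool,
    RecoversDistances (D n) G L ∧ totalLength L < (n : ℝ) ^ (3 / 2 : ℝ) / lam ^ (a + k + 24)}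
  set N : Set (Fin n → ℝ) := {p | ¬ TypicalWeights a k δ p} with hN
  set P := Measure.pi fun _ : Fin n => powerLaw β xmin with hP
  rw [powerLawGraph, Measure.bind_apply .of_discrete measurable_chungLuMeasure.aemeasurable,
    ENNReal.ofReal_add measureReal_nonneg (by positivity), ofReal_measureReal]
  have hle : ∀ p, chungLuMeasure p E ≤
      (toMeasurable P N).indicator 1 p + ENNReal.ofReal (66 / lam) := by
    intro p
    by_cases hp : p ∈ toMeasurable P N
    · rw [Set.indicator_of_mem hp]
      exact le_add_right prob_le_one
    · have hp' : TypicalWeights a k δ p := by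
        by_contra h
        exact hp (subset_toMeasurable P N h)
      refine le_add_left ?_
      rw [← ofReal_measureReal]
      exact ENNReal.ofReal_le_ofReal (chungLuMeasure_totalLength_lt_le hδ hlam hp' h1 hδlam hlam2
        hlamlog hn1 hn2 (D n))
  refine (lintegral_mono hle).trans (le_of_eq ?_)
  rw [lintegral_add_right _ measurable_const, lintegral_indicator_one (measurableSet_toMeasurable _ _),
    measure_toMeasurable, lintegral_const, measure_univ, mul_one]

theorem mainTheorem3 (β xmin : ℝ) (hβ : 3 < β) (hxmin : 0 < xmin)
    (hν : 1 < ∫ x, x ∂(powerLaw β xmin)) :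
    ∃ (c : ℝ) (k : ℕ), 0 < c ∧
      (∀ D : ℕ → List Bool → List Bool → ℕ∞,
        Filter.Tendsto
          (fun n : ℕ => powerLawGraph β xmin n
            {G | ∀ L : Fin n → List Bool, RecoversDistances (D n) G L →
              c * (n : ℝ) ^ (3 / 2 : ℝ) / Real.log n ^ k ≤ totalLength L})
          Filter.atTop (nhds 1)) ∧
      Filter.Tendsto
        (fun n : ℕ => powerLawGraph β xmin n
          {G | ∀ LF LB : Fin n → Finset (Fin n), IsTwoHopCover G LF LB →
            c * (n : ℝ) ^ (3 / 2 : ℝ) / Real.log n ^ k ≤ totalLandmarks LF LB})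
        Filter.atTop (nhds 1) := by
  obtain ⟨k, hk⟩ := exists_tendsto_totalLength_lt hβ hxmin hν
  have hprob : ∀ n, IsProbabilityMeasure (powerLawGraph β xmin n) := fun n =>
    isProbabilityMeasure_powerLawGraph (by linarith) hxmin n
  -- It suffices that every graph outside `E n` has a correct labeling that is too short.
  have key : ∀ (D : ℕ → List Bool → List Bool → ℕ∞) (E : ∀ n, Set (SimpleGraph (Fin n))),
      (∀ᶠ n in Filter.atTop, (E n)ᶜ ⊆ {G | ∃ L : Fin n → List Bool, RecoversDistances (D n) G L ∧
        totalLength L < (n : ℝ) ^ (3 / 2 : ℝ) / Real.log n ^ k}) →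
      Filter.Tendsto (fun n : ℕ => powerLawGraph β xmin n (E n)) Filter.atTop (nhds 1) := by
    intro D E hE
    have h := ENNReal.Tendsto.sub (tendsto_const_nhds (x := (1 : ENNReal))) (hk D)
      (Or.inl ENNReal.one_ne_top)
    rw [tsub_zero] at h
    refine tendsto_of_tendsto_of_tendsto_of_le_of_le' h tendsto_const_nhds ?_
      (Filter.Eventually.of_forall fun n => prob_le_one)
    filter_upwards [hE] with n hn
    rw [tsub_le_iff_right, ← prob_add_prob_compl (μ := powerLawGraph β xmin n)
      (MeasurableSet.of_discrete (s := E n))]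
    exact add_le_add_right (measure_mono hn) _
  have hpow : ∀ {n : ℕ}, 5 ≤ Real.log n →
      1 * (n : ℝ) ^ (3 / 2 : ℝ) / Real.log n ^ (k + 2) * (5 * Real.log n) ≤
        (n : ℝ) ^ (3 / 2 : ℝ) / Real.log n ^ k := by
    intro n hn
    have hlam : 0 < Real.log n := by linarith
    have h0 : 0 ≤ (n : ℝ) ^ (3 / 2 : ℝ) / Real.log n ^ k := by positivity
    calc 1 * (n : ℝ) ^ (3 / 2 : ℝ) / Real.log n ^ (k + 2) * (5 * Real.log n) =
          (n : ℝ) ^ (3 / 2 : ℝ) / Real.log n ^ k * (5 / Real.log n) := by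
          field_simp
          ring
      _ ≤ (n : ℝ) ^ (3 / 2 : ℝ) / Real.log n ^ k * 1 := by
          refine mul_le_mul_of_nonneg_left ?_ h0
          rw [div_le_one hlam]
          linarith
      _ = _ := mul_one _
  choose D₀ hD₀ using exists_decoder_of_twoHopCover
  refine ⟨1, k + 2, one_pos, fun D => key D _ ?_, key D₀ _ ?_⟩
  · filter_upwards [tendsto_log_natCast.eventually_ge_atTop 5] with n hn G hG
    simp only [Set.mem_compl_iff, Set.mem_ofPred_eq, not_forall, not_le] at hG
    obtain ⟨L, hL, hlt⟩ := hG
    refine ⟨L, hL, hlt.trans_le (le_trans ?_ (hpow hn))⟩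
    refine le_mul_of_one_le_right ?_ (by linarith)
    have : 0 ≤ Real.log n := by linarith
    positivity
  · filter_upwards [tendsto_log_natCast.eventually_ge_atTop 5,
      Filter.eventually_gt_atTop 0] with n hn hn0 G hG
    simp only [Set.mem_compl_iff, Set.mem_ofPred_eq, not_forall, not_le] at hG
    obtain ⟨LF, LB, hcov, hlt⟩ := hG
    obtain ⟨L, hL, hlen⟩ := hD₀ n G LF LB hcov
    refine ⟨L, hL, lt_of_lt_of_le ?_ (hpow hn)⟩
    have hbits : ((2 * Nat.log 2 n + 4 : ℕ) : ℝ) ≤ 5 * Real.log n := by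
      have h1 : (2 : ℝ) ^ Nat.log 2 n ≤ n := by exact_mod_cast Nat.pow_log_le_self 2 hn0.ne'
      have h2 := Real.log_le_log (by positivity) h1
      rw [Real.log_pow] at h2
      have h3 := Real.log_two_gt_d9
      have h4 : (0 : ℝ) ≤ Nat.log 2 n := Nat.cast_nonneg _
      push_cast
      nlinarith
    rw [hlen]
    push_cast at hbits ⊢
    calc (totalLandmarks LF LB : ℝ) * (2 * Nat.log 2 n + 4) ≤
          totalLandmarks LF LB * (5 * Real.log n) :=
          mul_le_mul_of_nonneg_left hbits (Nat.cast_nonneg _)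
      _ < _ := mul_lt_mul_of_pos_right hlt (by linarith)
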